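/- A seller has $m \ge 1$ items. Item $i$ departs after a random integer horizon $h_i \ge 1$ with known distribution $H_i$; the horizons are independent, and their distributions may differ. Each $H_i$ satisfies the monotone-hazard-rate (MHR) condition $$\Pr[h_i \ge t+2 \mid h_i \ge t+1] \le \Pr[h_i \ge t+1 \mid h_i \ge t] \quad \text{for all integers } t \ge 1$$ (the condition at $t$ is void if $\Pr[h_i \ge t+1] = 0$). Unit-demand buyers $t = 1, 2, \dots$ arrive one at a time. Buyer $t$ has value $X_t \ge 0$ for receiving any one item, where $X_1, X_2, \dots$ are i.i.d. from a known distribution $V$ and independent of the horizons. Item $i$ can be sold to buyer $t$ only if $t \le h_i$, and every item can be sold at most once. An online pricing policy knows $m$, $V$ and the $H_i$, and may use private randomness independent of horizons and values. When buyer $t$ arrives, it knows which unsold items are present now and which were present on earlier arrivals, and which earlier buyers bought, but neither the values of any buyers nor future departures. It then either offers nothing or posts a price for an item of its choice; if that item is present, the buyer buys it if her value exceeds the price, and if her value equals the price the policy decides whether she buys. Its welfare is the sum of the values of the buyers who receive an item. The prophet knows all realized horizons and values; its welfare is the maximum total value of an assignment of items to distinct buyers in which item $i$ is assigned to at most one buyer,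 who arrives no later than time $h_i$. Then for all such $m$, $H_1, \dots, H_m$ and $V$ there is an online pricing policy with $$\mathbb{E}[\text{welfare of the prophet}] \le 52.5 \cdot \mathbb{E}[\text{welfare of the policy}].$$ -/

import Mathlib

open MeasureTheory ProbabilityTheory
open scoped NNReal ENNReal

/-- The monotone-hazard-rate condition for the law `H` of a horizon:
`Pr[h ≥ t + 2 | h ≥ t + 1] ≤ Pr[h ≥ t + 1 | h ≥ t]` for all `t ≥ 1`.
(The conditional probability given a null event is `0` here; since the tails of `H` decrease,
such events put no constraint on `H`.) -/
def IsMHR (H : Measure ℕ) : Prop :=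
  ∀ t : ℕ, 1 ≤ t →
    cond H (Set.Ici (t + 1)) (Set.Ici (t + 2)) ≤ cond H (Set.Ici t) (Set.Ici (t + 1))

/-- What the seller has observed when a buyer arrives: for each earlier buyer, latest first, the
set of items that were on hand (neither sold nor departed) when that buyer arrived and whether
that buyer bought; and the set of items that are on hand now. -/
abbrev Info (m : ℕ) : Type := List (Finset (Fin m) × Bool) × Finset (Fin m)

/-- A (possibly randomized) online pricing policy for `m` items. Private randomness is drawn from
a probability space `Seed`. From the seed and the observations made so far, and without seeing the
value of the arriving buyer (or of any earlier one), the policy chooses the item it would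
hand out (`none`: it offers nothing), the price it posts, and whether a buyer whose value equals
the price buys. -/
structure PricingPolicy (m : ℕ) where
  Seed : Type
  [seedSpace : MeasurableSpace Seed]
  seedLaw : Measure Seed
  [isProbabilityMeasure_seedLaw : IsProbabilityMeasure seedLaw]
  item : Seed → Info m → Option (Fin m)
  price : Seed → Info m → ℝ≥0
  tie : Seed → Info m → Bool
  measurableSet_item : ∀ (I : Info m) (o : Option (Fin m)), MeasurableSet {s | item s I = o}
  measurable_price : ∀ I : Info m, Measurable fun s => price s I
  measurable_tie : ∀ I : Info m, Measurable fun s => tie s I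

attribute [instance] PricingPolicy.seedSpace PricingPolicy.isProbabilityMeasure_seedLaw

noncomputable section

/-- The items on hand when buyer `t + 1` arrives: those not in `sold` whose horizon is at least
`t + 1`. (An item with horizon `k` can be sold to the buyers `1, …, k`.) -/
def onHand {m : ℕ} (h : Fin m → ℕ) (sold : Finset (Fin m)) (t : ℕ) : Finset (Fin m) :=
  Finset.univ.filter fun i => i ∉ sold ∧ t + 1 ≤ h i

namespace PricingPolicy

variable {m : ℕ} (π : PricingPolicy m)

/-- The item sold to a buyer of value `v` who arrives when the seller's information is `I`. -/
def sale (s : π.Seed) (I : Info m) (v : ℝ≥0) : Option (Fin m) :=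
  match π.item s I with
  | none => none
  | some i =>
    if i ∈ I.2 ∧ (π.price s I < v ∨ (π.price s I = v ∧ π.tie s I = true)) then some i else none

/-- The record of past observations and the set of items sold, after the first `t` buyers, when
the seed is `s`, item `i` has horizon `h i`, and buyer `t + 1` has value `x t`. -/
def state (s : π.Seed) (h : Fin m → ℕ) (x : ℕ → ℝ≥0) :
    ℕ → List (Finset (Fin m) × Bool) × Finset (Fin m)
  | 0 => ([], ∅)
  | t + 1 =>
    let past := (state s h x t).1
    let sold := (state s h x t).2
    let now := onHand h sold t
    let o := π.sale s (past, now) (x t)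
    ((now, o.isSome) :: past, sold ∪ o.toFinset)

/-- The item sold to buyer `t + 1`, if any. -/
def saleAt (s : π.Seed) (h : Fin m → ℕ) (x : ℕ → ℝ≥0) (t : ℕ) : Option (Fin m) :=
  π.sale s ((π.state s h x t).1, onHand h (π.state s h x t).2 t) (x t)

/-- The realized welfare of the policy: the total value of the buyers who receive an item. -/
def welfare (s : π.Seed) (h : Fin m → ℕ) (x : ℕ → ℝ≥0) : ℝ≥0∞ :=
  ∑' t : ℕ, if (π.saleAt s h x t).isSome then (x t : ℝ≥0∞) else 0

/-- The expected welfare of the policy, when item `i` has horizon law `H i`, buyer values have law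
`V`, and horizons, values and the seed are all independent. -/
def expectedWelfare (H : Fin m → Measure ℕ) [∀ i, IsProbabilityMeasure (H i)]
    (V : Measure ℝ≥0) [IsProbabilityMeasure V] : ℝ≥0∞ :=
  ∫⁻ ω, π.welfare ω.1 ω.2.1 ω.2.2
    ∂(π.seedLaw.prod ((Measure.pi H).prod (Measure.infinitePi fun _ : ℕ => V)))

end PricingPolicy

/-- `σ` assigns items to distinct buyers (`σ i = some t`: item `i` goes to buyer `t + 1`;
`σ i = none`: item `i` is not used), each within the horizon of the item. -/
def IsFeasible {m : ℕ} (h : Fin m → ℕ) (σ : Fin m → Option ℕ) : Prop :=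
  (∀ i t, σ i = some t → t + 1 ≤ h i) ∧ ∀ i j t, σ i = some t → σ j = some t → i = j

/-- The total value of the buyers served by `σ`. -/
def assignmentValue {m : ℕ} (x : ℕ → ℝ≥0) (σ : Fin m → Option ℕ) : ℝ≥0∞ :=
  ∑ i, match σ i with
    | none => 0
    | some t => (x t : ℝ≥0∞)

/-- The welfare of the prophet, who knows all horizons and all values: the largest total value of
a feasible assignment. -/
def prophetWelfare {m : ℕ} (h : Fin m → ℕ) (x : ℕ → ℝ≥0) : ℝ≥0∞ :=
  ⨆ (σ : Fin m → Option ℕ) (_ : IsFeasible h σ), assignmentValue x σ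

/-- The expected welfare of the prophet. -/
def expectedProphetWelfare {m : ℕ} (H : Fin m → Measure ℕ) [∀ i, IsProbabilityMeasure (H i)]
    (V : Measure ℝ≥0) [IsProbabilityMeasure V] : ℝ≥0∞ :=
  ∫⁻ ω, prophetWelfare ω.1 ω.2 ∂((Measure.pi H).prod (Measure.infinitePi fun _ : ℕ => V))

end

/-!
Buyer `t + 1` and the value `x t` are numbered from `t = 0`, so `f i t = Pr[h i ≥ t + 1]` is the
probability that item `i` is still there for that buyer, and `tailSum (f i) t` is the sum of
`f i` from `t` on. The constant reached is `16`.

*Policy.* Item `i` is to be sold at time `t` with probability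
`a t i = f i t / tailSum (f i) t`, the inverse of its mean residual life. The probability that this
does not happen before time `t` is `tailSum (f i) t / tailSum (f i) 0`
(`IsMHRTail.prod_one_sub_inverseResidualLife`), so the intended time of sale has the equilibrium
distribution of the horizon. When `U` is on hand, the policy sets a price, with a random answer to
ties, at which the buyer is accepted with probability
`saleProb (a t) U = 1 - ∏ i ∈ U, (1 - a t i)`, the probability that one of the items is to be sold
if these events are independent. It hands out a random item of `U`. For fixed horizons, what
remains on hand is at least as good as if every item were removed with probability `a t i` at each
time, independently. This comparison is needed, and proved by induction on time, only for
expectations of `1 - ∏ i ∈ U, (1 - c i)` (`ThinningRule.lintegral_prod_stock_le`).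

*Levels.* By the layer-cake formula it suffices to compare policy and prophet when values above `v`
count as `1` and the others as `0`, for each `v`; let `θ = Pr[X > v]`. The policy does not depend on
`v`, and because it accepts the buyers of highest value, buyer `t + 1` counts for the policy
with probability `min (saleProb (a t) U) θ` given `U`. Averaging over `U` shows that the policy
gets at least `(1 / 4) ∑' t, min θ (y t)`, where
`y t = ∑ i, (f i t / tailSum (f i) 0) * min (f i t) (θ * tailSum (f i) t)`
(`ThinningRule.tsum_min_saleRate_le`).

*Prophet.* For every `N`, the prophet gets at most the buyers above the level among the first `N`
and, from item `i`, at most `1` if it survives beyond `N`, or at most all buyers above the level in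
its life beyond `N`; that is `N * θ + ∑ i, min (f i N) (θ * tailSum (f i) N)` in expectation
(`lintegral_prophetWelfare_level_le`).

*Comparison.* The sequence `y` is nonincreasing. With `τ` the first time at which `y τ ≤ θ`, the
policy gets `θ` at each of the times before `τ` and `y` afterwards. The prophet bound is used with
`N = 2 * τ`: by the MHR condition, the probability `f i (2 * τ) / f i τ` that an item survives from
`τ` to `2 * τ` is at most twice the probability `tailSum (f i) τ / tailSum (f i) 0` that it is not
to be sold before `τ` (`IsMHRTail.double_mul_le`), so what the policy can still earn with the item
from `τ` on is comparable to what the prophet can earn with it from `2 * τ` on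
(`IsMHRTail.quarter_min_le_tsum_saleRate`).
-/

/-! ### Log-concave tails with finite mean -/

lemma mul_succ_le_of_logConcave {f : ℕ → ℝ} (hnonneg : ∀ t, 0 ≤ f t) (hanti : Antitone f)
    (hlog : ∀ t, f (t + 2) * f t ≤ f (t + 1) * f (t + 1)) (t d : ℕ) :
    f (t + d + 1) * f t ≤ f (t + 1) * f (t + d) := by
  induction d with
  | zero => simp
  | succ d ih =>
    rcases (hnonneg (t + d)).eq_or_lt with h0 | h0
    · have h1 : f (t + (d + 1) + 1) = 0 := le_antisymm (h0 ▸ hanti (by omega)) (hnonneg _)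
      rw [h1, zero_mul]
      exact mul_nonneg (hnonneg _) (hnonneg _)
    · have h1 := hlog (t + d)
      have h2 := mul_le_mul_of_nonneg_right h1 (hnonneg t)
      have h3 := mul_le_mul_of_nonneg_left ih (hnonneg (t + d + 1))
      refine le_of_mul_le_mul_right ?_ h0
      have e1 : t + (d + 1) + 1 = t + d + 2 := by omega
      have e2 : t + (d + 1) = t + d + 1 := by omega
      rw [e1, e2]
      linarith

/-- The properties of the tail function `f t = Pr[h ≥ t + 1]` of an MHR horizon `h ≥ 1`:
it starts at `1`, decreases, is log-concave, and has a finite sum (the mean of `h`). -/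
structure IsMHRTail (f : ℕ → ℝ) : Prop where
  nonneg : ∀ t, 0 ≤ f t
  antitone : Antitone f
  zero : f 0 = 1
  logConcave : ∀ t, f (t + 2) * f t ≤ f (t + 1) * f (t + 1)
  summable : Summable f

/-- The sum of `f` from `t` on. For the tail function of a horizon `h`, this is the mean of
`(h - t)⁺`. -/
noncomputable def tailSum (f : ℕ → ℝ) (t : ℕ) : ℝ := ∑' k, f (t + k)

/-- The probability that an item with tail function `f` is still there for buyer `t + 1` and is then
sold, when at each time `s` it is to be sold with probability `f s / tailSum f s`, this probability
being capped by `θ` for buyer `t + 1` herself. -/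
noncomputable def saleRate (f : ℕ → ℝ) (θ : ℝ) (t : ℕ) : ℝ :=
  f t / tailSum f 0 * min (f t) (θ * tailSum f t)

namespace IsMHRTail

variable {f : ℕ → ℝ}

lemma summable_shift (hf : IsMHRTail f) (t : ℕ) : Summable fun k => f (t + k) := by
  simpa [add_comm] using (summable_nat_add_iff t).2 hf.summable

lemma tailSum_nonneg (hf : IsMHRTail f) (t : ℕ) : 0 ≤ tailSum f t :=
    tsum_nonneg fun _ => hf.nonneg _

lemma tailSum_eq_add (hf : IsMHRTail f) (t : ℕ) : tailSum f t = f t + tailSum f (t + 1) := by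
  unfold tailSum
  rw [(hf.summable_shift t).tsum_eq_zero_add]
  simp [add_comm, add_left_comm]

lemma le_tailSum (hf : IsMHRTail f) (t : ℕ) : f t ≤ tailSum f t := by
  have := hf.tailSum_nonneg (t + 1)
  rw [hf.tailSum_eq_add t]; linarith

lemma tailSum_antitone (hf : IsMHRTail f) : Antitone (tailSum f) :=
  antitone_nat_of_succ_le fun t => by
    have := hf.nonneg t
    rw [hf.tailSum_eq_add t]; linarith

lemma one_le_tailSum_zero (hf : IsMHRTail f) : 1 ≤ tailSum f 0 := hf.zero ▸ hf.le_tailSum 0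

lemma tailSum_pos (hf : IsMHRTail f) {t : ℕ} (ht : 0 < f t) : 0 < tailSum f t :=
    ht.trans_le (hf.le_tailSum t)

lemma eq_zero_of_le (hf : IsMHRTail f) {s t : ℕ} (hst : s ≤ t) (hs : f s = 0) : f t = 0 :=
  le_antisymm (hs ▸ hf.antitone hst) (hf.nonneg t)

lemma tendsto_tailSum : Filter.Tendsto (tailSum f) Filter.atTop (nhds 0) := by
  have h := tendsto_sum_nat_add f
  refine h.congr fun t => ?_
  simp [tailSum, add_comm]

lemma mul_succ_le (hf : IsMHRTail f) (t d : ℕ) : f (t + d + 1) * f t ≤ f (t + 1) * f (t + d) :=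
  mul_succ_le_of_logConcave hf.nonneg hf.antitone hf.logConcave t d

/-- Residual survival probabilities decrease with age: `f (s + k) / f s ≤ f (t + k) / f t` for
`s = t + d`. -/
lemma mul_le_mul_shift (hf : IsMHRTail f) (t d k : ℕ) :
    f (t + d + k) * f t ≤ f (t + k) * f (t + d) := by
  induction k with
  | zero => simp [mul_comm]
  | succ k ih =>
    rcases (hf.nonneg (t + k)).eq_or_lt with h0 | h0
    · have h1 : f (t + d + (k + 1)) = 0 := hf.eq_zero_of_le (by omega) h0.symm
      rw [h1, zero_mul]
      exact mul_nonneg (hf.nonneg _) (hf.nonneg _)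
    · have h1 := hf.mul_succ_le (t + k) d
      have h2 := mul_le_mul_of_nonneg_right h1 (hf.nonneg t)
      have h3 := mul_le_mul_of_nonneg_left ih (hf.nonneg (t + k + 1))
      refine le_of_mul_le_mul_right ?_ h0
      have e1 : t + d + (k + 1) = t + k + d + 1 := by omega
      have e2 : t + (k + 1) = t + k + 1 := by omega
      have e3 : t + d + k = t + k + d := by omega
      rw [e1, e2]
      rw [e3] at h3
      linarith

/-- The ratio `f t / tailSum f t`, the inverse of the mean residual life, increases with `t`. -/
lemma mul_tailSum_le (hf : IsMHRTail f) {s t : ℕ} (h : t ≤ s) :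
    f t * tailSum f s ≤ f s * tailSum f t := by
  obtain ⟨d, rfl⟩ := Nat.exists_eq_add_of_le h
  unfold tailSum
  rw [← tsum_mul_left, ← tsum_mul_left]
  refine Summable.tsum_le_tsum (fun k => ?_) ((hf.summable_shift _).mul_left _)
    ((hf.summable_shift _).mul_left _)
  have := hf.mul_le_mul_shift t d k
  linarith

lemma summable_mul_tailSum (hf : IsMHRTail f) (t : ℕ) :
    Summable fun k => f (t + k) * tailSum f (t + k) :=
  Summable.of_nonneg_of_le (fun _ => mul_nonneg (hf.nonneg _) (hf.tailSum_nonneg _))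
    (fun _ => mul_le_mul_of_nonneg_left (hf.tailSum_antitone (Nat.zero_le _)) (hf.nonneg _))
    ((hf.summable_shift t).mul_right _)

lemma sq_tailSum_le (hf : IsMHRTail f) (t : ℕ) :
    tailSum f t ^ 2 / 2 ≤ ∑' k, f (t + k) * tailSum f (t + k) := by
  have key : ∀ n, tailSum f t ^ 2 / 2 - tailSum f (t + n) ^ 2 / 2
      ≤ ∑' k, f (t + k) * tailSum f (t + k) := by
    intro n
    refine le_trans ?_ ((hf.summable_mul_tailSum t).sum_le_tsum (Finset.range n)
      fun k _ => mul_nonneg (hf.nonneg _) (hf.tailSum_nonneg _))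
    induction n with
    | zero => simp
    | succ n ih =>
      rw [Finset.sum_range_succ]
      have h1 := hf.tailSum_eq_add (t + n)
      have h2 : f (t + n) * tailSum f (t + n) = tailSum f (t + n) ^ 2 / 2
          - tailSum f (t + n + 1) ^ 2 / 2 + f (t + n) ^ 2 / 2 := by
        rw [h1]; ring
      have h3 := sq_nonneg (f (t + n))
      rw [← add_assoc]
      linarith
  have hlim : Filter.Tendsto (fun n => tailSum f t ^ 2 / 2 - tailSum f (t + n) ^ 2 / 2)
      Filter.atTop (nhds (tailSum f t ^ 2 / 2 - 0 ^ 2 / 2)) := by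
    refine Filter.Tendsto.sub tendsto_const_nhds (Filter.Tendsto.div_const
      (Filter.Tendsto.pow ?_ 2) 2)
    have := (Filter.tendsto_add_atTop_iff_nat t).2 (tendsto_tailSum (f := f))
    simpa [add_comm] using this
  have := le_of_tendsto' hlim key
  simpa using this

/-- The part `tailSum f τ` of the mean that comes after time `τ` is at least half of the mean
`tailSum f 0`, times the probability `f (2 * τ) / f τ` of surviving from `τ` to `2 * τ`. -/
lemma double_mul_le (hf : IsMHRTail f) (τ : ℕ) :
    f (2 * τ) * tailSum f 0 ≤ 2 * (f τ * tailSum f τ) := by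
  have h0 : tailSum f 0 = ∑ s ∈ Finset.range τ, f s + tailSum f τ := by
    have := hf.summable.sum_add_tsum_nat_add τ
    simp only [tailSum, zero_add, add_comm τ]
    linarith
  have h1 : f (2 * τ) * ∑ s ∈ Finset.range τ, f s ≤ f τ * tailSum f τ := by
    calc f (2 * τ) * ∑ s ∈ Finset.range τ, f s
        = ∑ s ∈ Finset.range τ, f (2 * τ) * f s := Finset.mul_sum _ _ _
      _ ≤ ∑ s ∈ Finset.range τ, f τ * f (τ + s) := by
          refine Finset.sum_le_sum fun s hs => ?_
          have hs' := Finset.mem_range.1 hs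
          have := hf.mul_le_mul_shift s (τ - s) τ
          rw [show s + (τ - s) + τ = 2 * τ by omega, show s + (τ - s) = τ by omega,
            add_comm s τ] at this
          linarith
      _ = f τ * ∑ s ∈ Finset.range τ, f (τ + s) := (Finset.mul_sum _ _ _).symm
      _ ≤ f τ * tailSum f τ := mul_le_mul_of_nonneg_left
          ((hf.summable_shift τ).sum_le_tsum _ fun _ _ => hf.nonneg _) (hf.nonneg _)
  have h2 : f (2 * τ) * tailSum f τ ≤ f τ * tailSum f τ :=
    mul_le_mul_of_nonneg_right (hf.antitone (by omega)) (hf.tailSum_nonneg _)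
  rw [h0]
  linarith

lemma tailSum_double_mul_le (hf : IsMHRTail f) {τ : ℕ} (hτ : 0 < f τ) :
    tailSum f (2 * τ) * tailSum f 0 ≤ 2 * (tailSum f τ * tailSum f τ) := by
  refine le_of_mul_le_mul_left ?_ hτ
  have h1 := mul_le_mul_of_nonneg_right (hf.mul_tailSum_le (show τ ≤ 2 * τ by omega))
    (hf.tailSum_nonneg 0)
  have h2 := mul_le_mul_of_nonneg_right (hf.double_mul_le τ) (hf.tailSum_nonneg τ)
  linarith

lemma saleRate_nonneg (hf : IsMHRTail f) {θ : ℝ} (hθ : 0 ≤ θ) (t : ℕ) : 0 ≤ saleRate f θ t :=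
  mul_nonneg (div_nonneg (hf.nonneg _) (hf.tailSum_nonneg _))
    (le_min (hf.nonneg _) (mul_nonneg hθ (hf.tailSum_nonneg _)))

lemma saleRate_antitone (hf : IsMHRTail f) {θ : ℝ} (hθ : 0 ≤ θ) : Antitone (saleRate f θ) := by
  intro s t hst
  unfold saleRate
  have := hf.antitone hst
  have h2 := mul_le_mul_of_nonneg_left (hf.tailSum_antitone hst) hθ
  exact mul_le_mul (div_le_div_of_nonneg_right this (hf.tailSum_nonneg _))
    (min_le_min this h2) (le_min (hf.nonneg _) (mul_nonneg hθ (hf.tailSum_nonneg _)))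
    (div_nonneg (hf.nonneg _) (hf.tailSum_nonneg _))

lemma summable_saleRate (hf : IsMHRTail f) {θ : ℝ} (hθ : 0 ≤ θ) : Summable (saleRate f θ) := by
  refine Summable.of_nonneg_of_le (hf.saleRate_nonneg hθ) (fun t => ?_) hf.summable
  have h1 : f t ≤ 1 := hf.zero ▸ hf.antitone (Nat.zero_le t)
  have h2 : f t / tailSum f 0 ≤ f t := div_le_self (hf.nonneg t) hf.one_le_tailSum_zero
  calc saleRate f θ t ≤ f t * 1 :=
        mul_le_mul h2 ((min_le_left _ _).trans h1)
          (le_min (hf.nonneg _) (mul_nonneg hθ (hf.tailSum_nonneg _))) (hf.nonneg _)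
    _ = f t := mul_one _

/-- What a single item earns from time `τ` on is at least a quarter of the most that the prophet
can earn with it from time `2 τ` on. -/
lemma quarter_min_le_tsum_saleRate (hf : IsMHRTail f) {θ : ℝ} (hθ : 0 ≤ θ) (τ : ℕ) :
    min (f (2 * τ)) (θ * tailSum f (2 * τ)) ≤ 4 * ∑' k, saleRate f θ (τ + k) := by
  have hs : Summable fun k => saleRate f θ (τ + k) := by
    simpa [add_comm] using (summable_nat_add_iff τ).2 (hf.summable_saleRate hθ)
  rcases (hf.nonneg τ).eq_or_lt with h0 | h0
  · have h1 : f (2 * τ) = 0 := hf.eq_zero_of_le (by omega) h0.symm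
    have h2 : 0 ≤ ∑' k, saleRate f θ (τ + k) := tsum_nonneg fun k => hf.saleRate_nonneg hθ (τ + k)
    exact (min_le_left _ _).trans (by rw [h1]; linarith)
  set c := min (f τ) (θ * tailSum f τ) with hc
  have hG := hf.tailSum_pos h0
  have hμ : 0 < tailSum f 0 := one_pos.trans_le hf.one_le_tailSum_zero
  have hc0 : 0 ≤ c := le_min h0.le (mul_nonneg hθ hG.le)
  have h1 : c / (tailSum f 0 * tailSum f τ) * (tailSum f τ ^ 2 / 2)
      ≤ ∑' k, saleRate f θ (τ + k) := by
    refine (mul_le_mul_of_nonneg_left (hf.sq_tailSum_le τ) (by positivity)).trans ?_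
    rw [← tsum_mul_left]
    refine Summable.tsum_le_tsum (fun k => ?_) ((hf.summable_mul_tailSum τ).mul_left _) hs
    have hk := hf.mul_tailSum_le (Nat.le_add_right τ k)
    have hmin : c * tailSum f (τ + k) ≤
        min (f (τ + k)) (θ * tailSum f (τ + k)) * tailSum f τ := by
      rw [min_mul_of_nonneg _ _ hG.le]
      refine le_min ?_ ?_
      · exact (mul_le_mul_of_nonneg_right (min_le_left _ _) (hf.tailSum_nonneg _)).trans hk
      · calc c * tailSum f (τ + k) ≤ θ * tailSum f τ * tailSum f (τ + k) :=
              mul_le_mul_of_nonneg_right (min_le_right _ _) (hf.tailSum_nonneg _)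
          _ = _ := by ring
    calc c / (tailSum f 0 * tailSum f τ) * (f (τ + k) * tailSum f (τ + k))
        = f (τ + k) / (tailSum f 0 * tailSum f τ) * (c * tailSum f (τ + k)) := by ring
      _ ≤ f (τ + k) / (tailSum f 0 * tailSum f τ) *
          (min (f (τ + k)) (θ * tailSum f (τ + k)) * tailSum f τ) :=
          mul_le_mul_of_nonneg_left hmin (div_nonneg (hf.nonneg _) (by positivity))
      _ = saleRate f θ (τ + k) := by
          unfold saleRate
          field_simp
  have h2 : min (f (2 * τ)) (θ * tailSum f (2 * τ)) * tailSum f 0 ≤ 2 * (c * tailSum f τ) := by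
    rw [hc, min_mul_of_nonneg _ _ hG.le, mul_min_of_nonneg _ _ zero_le_two]
    refine le_min ?_ ?_
    · exact (mul_le_mul_of_nonneg_right (min_le_left _ _) hμ.le).trans (hf.double_mul_le τ)
    · refine (mul_le_mul_of_nonneg_right (min_le_right _ _) hμ.le).trans ?_
      have := mul_le_mul_of_nonneg_left (hf.tailSum_double_mul_le h0) hθ
      linarith
  have h3 : c / (tailSum f 0 * tailSum f τ) * (tailSum f τ ^ 2 / 2)
      = 2 * (c * tailSum f τ) / tailSum f 0 / 4 := by
    field_simp
    ring
  have h4 := (le_div_iff₀ hμ).2 h2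
  linarith

end IsMHRTail

/-- The comparison at a level exceeded with probability `θ`: the right side is, up to a constant, a
lower bound on the welfare of the policy, the left side an upper bound on that of the prophet, who
serves at most the buyers above the level among the first `2 * τ` and then uses each remaining item
at most once. -/
lemma exists_cutoff {ι : Type*} [Fintype ι] {f : ι → ℕ → ℝ} (hf : ∀ i, IsMHRTail (f i)) {θ : ℝ}
    (hθ : 0 ≤ θ) : ∃ τ : ℕ,
      (2 * τ : ℕ) * θ + ∑ i, min (f i (2 * τ)) (θ * tailSum (f i) (2 * τ))
        ≤ 4 * ∑' t, min θ (∑ i, saleRate (f i) θ t) := by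
  classical
  set y : ℕ → ℝ := fun t => ∑ i, saleRate (f i) θ t with hy
  have hysum : Summable y := summable_sum fun i _ => (hf i).summable_saleRate hθ
  have hy0 : ∀ t, 0 ≤ y t := fun t => Finset.sum_nonneg fun i _ => (hf i).saleRate_nonneg hθ t
  have hyanti : Antitone y := fun s t hst =>
    Finset.sum_le_sum fun i _ => (hf i).saleRate_antitone hθ hst
  have hex : ∃ τ, y τ ≤ θ := by
    rcases hθ.eq_or_lt with h | h
    · refine ⟨0, ?_⟩
      simp only [hy, ← h, saleRate, zero_mul]
      exact Finset.sum_nonpos fun i _ => by simp [(hf i).nonneg]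
    · exact ((hysum.tendsto_atTop_zero.eventually (ge_mem_nhds h))).exists
  -- The rates `y t` are nonincreasing, so `y t ≥ θ` before `τ` and `y t ≤ θ` from `τ` on.
  set τ := Nat.find hex
  have hmsum : Summable fun t => min θ (y t) :=
    Summable.of_nonneg_of_le (fun t => le_min hθ (hy0 t)) (fun t => min_le_right _ _) hysum
  have hlow : ∀ t ∈ Finset.range τ, min θ (y t) = θ := fun t ht =>
    min_eq_left (not_le.1 (Nat.find_min hex (Finset.mem_range.1 ht))).le
  have hhigh : ∀ k, min θ (y (k + τ)) = y (k + τ) := fun k =>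
    min_eq_right ((hyanti (Nat.le_add_left τ k)).trans (Nat.find_spec hex))
  refine ⟨τ, ?_⟩
  rw [← hmsum.sum_add_tsum_nat_add τ, Finset.sum_congr rfl hlow, tsum_congr hhigh]
  have h1 : ∑' k, y (k + τ) = ∑ i, ∑' k, saleRate (f i) θ (τ + k) := by
    simp only [hy, add_comm _ τ]
    refine Summable.tsum_finsetSum fun i _ => ?_
    simpa [add_comm] using (summable_nat_add_iff τ).2 ((hf i).summable_saleRate hθ)
  have h2 : ∑ i, min (f i (2 * τ)) (θ * tailSum (f i) (2 * τ))
      ≤ ∑ i, 4 * ∑' k, saleRate (f i) θ (τ + k) :=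
    Finset.sum_le_sum fun i _ => (hf i).quarter_min_le_tsum_saleRate hθ τ
  rw [← Finset.mul_sum] at h2
  rw [h1]
  simp only [Finset.sum_const, Finset.card_range, nsmul_eq_mul]
  push_cast
  have : 0 ≤ (τ : ℝ) * θ := by positivity
  linarith

/-! ### From the hazard-rate condition to tails; prices and item probabilities -/

lemma IsMHR.isMHRTail {H : Measure ℕ} [IsProbabilityMeasure H] (hH : IsMHR H) (h0 : H {0} = 0) :
    IsMHRTail fun t => H.real (Set.Ici (t + 1)) := by
  set f : ℕ → ℝ := fun t => H.real (Set.Ici (t + 1)) with hfdef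
  have hnonneg : ∀ t, 0 ≤ f t := fun t => measureReal_nonneg
  have hanti : Antitone f := fun s t hst =>
    measureReal_mono (Set.Ici_subset_Ici.2 (by omega)) (measure_ne_top _ _)
  have hzero : f 0 = 1 := by
    have h : Set.Ici (0 + 1) = ({0} : Set ℕ)ᶜ := by ext n; simp; omega
    simp only [hfdef, h]
    rw [probReal_compl_eq_one_sub (measurableSet_singleton 0)]
    simp [measureReal_def, h0]
  have hlog : ∀ t, f (t + 2) * f t ≤ f (t + 1) * f (t + 1) := by
    intro t
    have h := hH (t + 1) (by omega)
    rw [cond_apply measurableSet_Ici, cond_apply measurableSet_Ici,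
      Set.inter_eq_self_of_subset_right (Set.Ici_subset_Ici.2 (by omega)),
      Set.inter_eq_self_of_subset_right (Set.Ici_subset_Ici.2 (by omega))] at h
    rcases (hnonneg (t + 1)).eq_or_lt with h1 | h1
    · have h2 : f (t + 2) = 0 := le_antisymm (h1 ▸ hanti (by omega)) (hnonneg _)
      rw [h2, ← h1]; simp
    · have h2 : 0 < f t := h1.trans_le (hanti (by omega))
      have hne : ∀ s, 0 < f s → H (Set.Ici (s + 1)) ≠ 0 := by
        intro s hs h
        simp [hfdef, measureReal_def, h] at hs
      have h3 := ENNReal.toReal_mono (ENNReal.mul_ne_top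
        (ENNReal.inv_ne_top.2 (hne t h2)) (measure_ne_top _ _)) h
      rw [ENNReal.toReal_mul, ENNReal.toReal_mul, ENNReal.toReal_inv, ENNReal.toReal_inv] at h3
      change (f (t + 1))⁻¹ * f (t + 2) ≤ (f t)⁻¹ * f (t + 1) at h3
      rw [inv_mul_eq_div, inv_mul_eq_div, div_le_div_iff₀ h1 h2] at h3
      exact h3
  have hlim : Filter.Tendsto f Filter.atTop (nhds 0) := by
    have h := tendsto_measure_iInter_atTop (μ := H) (s := fun t : ℕ => Set.Ici (t + 1))
      (fun _ => measurableSet_Ici.nullMeasurableSet)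
      (fun s t hst => Set.Ici_subset_Ici.2 (by omega)) ⟨0, measure_ne_top _ _⟩
    have he : (⋂ t : ℕ, Set.Ici (t + 1)) = (∅ : Set ℕ) := by
      ext n
      simp only [Set.mem_iInter, Set.mem_Ici, Set.mem_empty_iff_false, iff_false, not_forall]
      exact ⟨n, by omega⟩
    rw [he, measure_empty] at h
    exact (ENNReal.tendsto_toReal ENNReal.zero_ne_top).comp h
  refine ⟨hnonneg, hanti, hzero, hlog, ?_⟩
  obtain ⟨t₀, ht₀⟩ : ∃ t, f (t + 1) < f t := by
    by_contra! hcon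
    have h1 : ∀ t, f t = 1 := fun t => by
      induction t with
      | zero => exact hzero
      | succ t ih => exact le_antisymm (ih ▸ hanti (Nat.le_succ t)) (ih ▸ hcon t)
    rw [show f = fun _ => 1 from funext h1] at hlim
    exact one_ne_zero (tendsto_nhds_unique tendsto_const_nhds hlim)
  have hpos : 0 < f t₀ := (hnonneg _).trans_lt ht₀
  refine summable_of_ratio_norm_eventually_le (r := f (t₀ + 1) / f t₀)
    ((div_lt_one hpos).2 ht₀) ?_
  filter_upwards [Filter.eventually_ge_atTop t₀] with n hn
  obtain ⟨d, rfl⟩ := Nat.exists_eq_add_of_le hn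
  rw [Real.norm_of_nonneg (hnonneg _), Real.norm_of_nonneg (hnonneg _), div_mul_eq_mul_div,
    le_div_iff₀ hpos]
  exact mul_succ_le_of_logConcave hnonneg hanti hlog t₀ d

/-- Every acceptance probability is attained by a price, with a tie accepted with a suitable
probability. -/
lemma exists_price_tie (V : Measure ℝ≥0) [IsProbabilityMeasure V] {q : ℝ} (hq1 : q ≤ 1) :
    ∃ (p : ℝ≥0) (k : ℝ), 0 ≤ k ∧ k ≤ 1 ∧
      (0 < q → V.real (Set.Ioi p) + k * V.real {p} = q) := by
  rcases le_or_gt q 0 with hq | hq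
  · exact ⟨0, 0, le_rfl, zero_le_one, fun h => absurd h hq.not_gt⟩
  set S : Set ℝ≥0 := {v | V.real (Set.Ioi v) ≤ q} with hS
  have hSne : S.Nonempty := by
    have h := tendsto_measure_iInter_atTop (μ := V) (s := fun t : ℕ => Set.Ioi (t : ℝ≥0))
      (fun _ => measurableSet_Ioi.nullMeasurableSet)
      (fun s t hst => Set.Ioi_subset_Ioi (by exact_mod_cast hst)) ⟨0, measure_ne_top _ _⟩
    have he : (⋂ t : ℕ, Set.Ioi (t : ℝ≥0)) = ∅ := by
      ext x
      simp only [Set.mem_iInter, Set.mem_Ioi, Set.mem_empty_iff_false, iff_false, not_forall,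
        not_lt]
      exact exists_nat_ge x
    rw [he, measure_empty] at h
    have h2 := (ENNReal.tendsto_toReal ENNReal.zero_ne_top).comp h
    obtain ⟨n, hn⟩ := (h2.eventually (ge_mem_nhds (by simpa using hq))).exists
    exact ⟨n, hn⟩
  set p := sInf S with hp
  have hmono : ∀ {v w}, v ≤ w → V.real (Set.Ioi w) ≤ V.real (Set.Ioi v) := fun h =>
    measureReal_mono (Set.Ioi_subset_Ioi h) (measure_ne_top _ _)
  have hup : V.real (Set.Ioi p) ≤ q := by
    obtain ⟨u, hu, hup, hut⟩ := exists_seq_strictAnti_tendsto p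
    have hU : Set.Ioi p = ⋃ n, Set.Ioi (u n) := by
      ext x
      simp only [Set.mem_Ioi, Set.mem_iUnion]
      exact ⟨fun hx => (hut.eventually (gt_mem_nhds hx)).exists,
        fun ⟨n, hn⟩ => (hup n).trans hn⟩
    have h := tendsto_measure_iUnion_atTop (μ := V) (s := fun n => Set.Ioi (u n))
      (fun s t hst => Set.Ioi_subset_Ioi (hu.antitone hst))
    rw [← hU] at h
    refine le_of_tendsto' ((ENNReal.tendsto_toReal (measure_ne_top _ _)).comp h) fun n => ?_
    obtain ⟨v, hv, hvn⟩ := exists_lt_of_csInf_lt hSne (hup n)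
    exact (hmono hvn.le).trans hv
  have hlow : q ≤ V.real (Set.Ici p) := by
    rcases eq_or_ne p 0 with h0 | h0
    · rw [h0, show Set.Ici (0 : ℝ≥0) = Set.univ by ext; simp]
      simpa using hq1
    · obtain ⟨u, hu, hup, hut⟩ := exists_seq_strictMono_tendsto' (pos_iff_ne_zero.2 h0)
      have hU : Set.Ici p = ⋂ n, Set.Ioi (u n) := by
        ext x
        simp only [Set.mem_Ici, Set.mem_iInter, Set.mem_Ioi]
        refine ⟨fun hx n => (hup n).2.trans_le hx, fun hx => ?_⟩
        by_contra hlt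
        obtain ⟨n, hn⟩ := (hut.eventually (lt_mem_nhds (not_le.1 hlt))).exists
        exact absurd (hx n) hn.not_gt
      have h := tendsto_measure_iInter_atTop (μ := V) (s := fun n => Set.Ioi (u n))
        (fun _ => measurableSet_Ioi.nullMeasurableSet)
        (fun s t hst => Set.Ioi_subset_Ioi (hu.monotone hst)) ⟨0, measure_ne_top _ _⟩
      rw [← hU] at h
      refine ge_of_tendsto' ((ENNReal.tendsto_toReal (measure_ne_top _ _)).comp h) fun n => ?_
      by_contra hlt
      have : u n ∈ S := (not_le.1 hlt).le
      exact absurd (csInf_le' this) (hup n).2.not_ge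
  have hsplit : V.real (Set.Ici p) = V.real (Set.Ioi p) + V.real {p} := by
    rw [← Set.Ioi_union_left, measureReal_union (by simp) (measurableSet_singleton p)]
  rcases (measureReal_nonneg (μ := V) (s := {p})).eq_or_lt with h0 | h0
  · exact ⟨p, 0, le_rfl, zero_le_one, fun _ => by linarith⟩
  · refine ⟨p, (q - V.real (Set.Ioi p)) / V.real {p}, div_nonneg (by linarith) h0.le,
      (div_le_one h0).2 (by linarith), fun _ => ?_⟩
    rw [div_mul_cancel₀ _ h0.ne']
    ring

section Weights

variable {ι : Type*}

/-- The probability that the next buyer gets an item when `U` is the set of items on hand: the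
same as if each item `i ∈ U` were to be sold with probability `a i`, independently. -/
noncomputable def saleProb (a : ι → ℝ) (U : Finset ι) : ℝ := 1 - ∏ i ∈ U, (1 - a i)

lemma prod_one_sub_le_one {a : ι → ℝ} (h0 : ∀ i, 0 ≤ a i) (h1 : ∀ i, a i ≤ 1) (U : Finset ι) :
    ∏ i ∈ U, (1 - a i) ≤ 1 :=
  Finset.prod_le_one (fun i _ => by linarith [h1 i]) fun i _ => by linarith [h0 i]

lemma prod_one_sub_nonneg {a : ι → ℝ} (h1 : ∀ i, a i ≤ 1) (U : Finset ι) :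
    0 ≤ ∏ i ∈ U, (1 - a i) := Finset.prod_nonneg fun i _ => by linarith [h1 i]

lemma saleProb_nonneg {a : ι → ℝ} (h0 : ∀ i, 0 ≤ a i) (h1 : ∀ i, a i ≤ 1) (U : Finset ι) :
    0 ≤ saleProb a U := by
  have := prod_one_sub_le_one h0 h1 U
  unfold saleProb; linarith

lemma saleProb_le_one {a : ι → ℝ} (h1 : ∀ i, a i ≤ 1) (U : Finset ι) : saleProb a U ≤ 1 := by
  have := prod_one_sub_nonneg h1 U
  unfold saleProb; linarith

/-- The law of the largest item sold when each item `i ∈ U` is sold with probability `a i`,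
independently, given that some item is sold. -/
lemma exists_itemWeight [LinearOrder ι] [Fintype ι] [Nonempty ι] {a : ι → ℝ} (h0 : ∀ i, 0 ≤ a i)
    (h1 : ∀ i, a i ≤ 1) (U : Finset ι) : ∃ w : ι → ℝ, (∀ i, 0 ≤ w i) ∧ ∑ i, w i = 1 ∧
      ∀ i, saleProb a U * w i = if i ∈ U then a i * ∏ j ∈ U with i < j, (1 - a j) else 0 := by
  have hsum : ∑ i, (if i ∈ U then a i * ∏ j ∈ U with i < j, (1 - a j) else 0) = saleProb a U := by
    rw [Finset.sum_ite_mem, Finset.univ_inter]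
    have := Finset.prod_add_ordered U (fun i => 1 - a i) a
    simp only [sub_add_cancel, Finset.prod_const_one, mul_one] at this
    unfold saleProb
    linarith
  have hterm : ∀ i, 0 ≤ (if i ∈ U then a i * ∏ j ∈ U with i < j, (1 - a j) else 0) := fun i => by
    split_ifs
    · exact mul_nonneg (h0 i) (prod_one_sub_nonneg h1 _)
    · exact le_rfl
  rcases (saleProb_nonneg h0 h1 U).eq_or_lt with hA | hA
  · obtain ⟨i₀⟩ := ‹Nonempty ι›
    refine ⟨fun i => if i = i₀ then 1 else 0, fun i => by
      dsimp only; split_ifs <;> norm_num, by simp,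
      fun i => ?_⟩
    rw [← hA, zero_mul]
    rw [← hA] at hsum
    exact ((Finset.sum_eq_zero_iff_of_nonneg fun i _ => hterm i).1 hsum i (Finset.mem_univ i)).symm
  · refine ⟨fun i => (if i ∈ U then a i * ∏ j ∈ U with i < j, (1 - a j) else 0) / saleProb a U,
      fun i => div_nonneg (hterm i) hA.le, ?_, fun i => mul_div_cancel₀ _ hA.ne'⟩
    rw [← Finset.sum_div, hsum, div_self hA.ne']

/-- Selling one item keeps at least as much on hand as removing each item `i` with probability
`a i`, independently, where the items left over are measured by `1 - ∏ i ∈ U, (1 - c i)`. -/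
lemma prod_one_sub_step_le [LinearOrder ι] [Fintype ι] {a c w : ι → ℝ} (ha0 : ∀ i, 0 ≤ a i)
    (ha1 : ∀ i, a i ≤ 1) (hc0 : ∀ i, 0 ≤ c i) (hc1 : ∀ i, c i ≤ 1) (U : Finset ι)
    (hw : ∀ i, saleProb a U * w i = if i ∈ U then a i * ∏ j ∈ U with i < j, (1 - a j) else 0) :
    (1 - saleProb a U) * ∏ i ∈ U, (1 - c i) +
      ∑ i, saleProb a U * w i * ∏ j ∈ U.erase i, (1 - c j) ≤ ∏ i ∈ U, (1 - (1 - a i) * c i) := by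
  have hord := Finset.prod_add_ordered U (fun i => (1 - a i) * (1 - c i)) a
  have e : ∀ i, 1 - (1 - a i) * c i = (1 - a i) * (1 - c i) + a i := fun i => by ring
  simp only [e]
  rw [hord]
  simp only [hw, ite_mul, zero_mul]
  rw [Finset.sum_ite_mem, Finset.univ_inter, Finset.prod_mul_distrib]
  refine add_le_add (le_of_eq (by unfold saleProb; ring)) (Finset.sum_le_sum fun i hi => ?_)
  have hsplit : ∏ j ∈ U.erase i, (1 - c j)
      = (∏ j ∈ U with j < i, (1 - c j)) * ∏ j ∈ U with i < j, (1 - c j) := by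
    rw [← Finset.prod_union]
    · refine Finset.prod_congr ?_ fun _ _ => rfl
      ext j
      simp only [Finset.mem_erase, Finset.mem_union, Finset.mem_filter]
      constructor
      · rintro ⟨hne, hj⟩
        exact (lt_or_gt_of_ne hne).imp (fun h => ⟨hj, h⟩) fun h => ⟨hj, h⟩
      · rintro (⟨hj, h⟩ | ⟨hj, h⟩)
        exacts [⟨h.ne, hj⟩, ⟨h.ne', hj⟩]
    · rw [Finset.disjoint_filter]
      exact fun j _ h => h.not_gt
  rw [hsplit, Finset.prod_mul_distrib]
  -- The items below `i` have a factor at least `1 - c j` on the right, whatever `a j` is; this is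
  -- why the weight of `i` contains the factors `1 - a j` of the larger items only.
  have hle : ∏ j ∈ U with j < i, (1 - c j)
      ≤ ∏ j ∈ U with j < i, ((1 - a j) * (1 - c j) + a j) :=
    Finset.prod_le_prod (fun j _ => by linarith [hc1 j]) fun j _ => by
      nlinarith [mul_nonneg (ha0 j) (hc0 j)]
  have hx : 0 ≤ a i * ((∏ j ∈ U with i < j, (1 - a j)) * ∏ j ∈ U with i < j, (1 - c j)) :=
    mul_nonneg (ha0 i) (mul_nonneg (prod_one_sub_nonneg ha1 _) (prod_one_sub_nonneg hc1 _))
  calc _ = a i * ((∏ j ∈ U with i < j, (1 - a j)) * ∏ j ∈ U with i < j, (1 - c j)) *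
        ∏ j ∈ U with j < i, (1 - c j) := by ring
    _ ≤ a i * ((∏ j ∈ U with i < j, (1 - a j)) * ∏ j ∈ U with i < j, (1 - c j)) *
        ∏ j ∈ U with j < i, ((1 - a j) * (1 - c j) + a j) := mul_le_mul_of_nonneg_left hle hx
    _ = _ := by ring

lemma one_sub_sum_le_prod {x : ι → ℝ} (h0 : ∀ i, 0 ≤ x i) (h1 : ∀ i, x i ≤ 1) (U : Finset ι) :
    1 - ∑ i ∈ U, x i ≤ ∏ i ∈ U, (1 - x i) := by
  classical
  induction U using Finset.induction_on with
  | empty => simp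
  | insert i U hi ih =>
    rw [Finset.sum_insert hi, Finset.prod_insert hi]
    have h2 := prod_one_sub_le_one h0 h1 U
    nlinarith [h0 i, h1 i, mul_nonneg (h0 i) (sub_nonneg.2 h2)]

lemma half_min_le_one_sub_prod {x : ι → ℝ} (h0 : ∀ i, 0 ≤ x i) (h1 : ∀ i, x i ≤ 1)
    (U : Finset ι) : min 1 (∑ i ∈ U, x i) / 2 ≤ 1 - ∏ i ∈ U, (1 - x i) := by
  set s := ∑ i ∈ U, x i
  have hs : 0 ≤ s := Finset.sum_nonneg fun i _ => h0 i
  have h2 : ∏ i ∈ U, (1 - x i) ≤ Real.exp (-s) := by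
    rw [← Finset.sum_neg_distrib, Real.exp_sum]
    exact Finset.prod_le_prod (fun i _ => by linarith [h1 i]) fun i _ =>
      Real.one_sub_le_exp_neg _
  have h3 : Real.exp (-s) * (1 + s) ≤ 1 := by
    have := mul_le_mul_of_nonneg_left (Real.add_one_le_exp s) (Real.exp_pos (-s)).le
    rw [← Real.exp_add, neg_add_cancel, Real.exp_zero] at this
    linarith
  rcases le_total s 1 with h | h
  · rw [min_eq_right h]
    nlinarith [Real.exp_pos (-s)]
  · rw [min_eq_left h]
    nlinarith [Real.exp_pos (-s)]

lemma le_min_saleProb {a : ι → ℝ} (h0 : ∀ i, 0 ≤ a i) (h1 : ∀ i, a i ≤ 1) {θ : ℝ} (hθ : 0 < θ)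
    (hθ1 : θ ≤ 1) (U : Finset ι) :
    θ / 2 * (1 - ∏ i ∈ U, (1 - min (a i) θ / θ)) ≤ min (saleProb a U) θ := by
  have hb0 : ∀ i, 0 ≤ min (a i) θ := fun i => le_min (h0 i) hθ.le
  have hb1 : ∀ i, min (a i) θ ≤ 1 := fun i => (min_le_left _ _).trans (h1 i)
  have hc0 : ∀ i, 0 ≤ min (a i) θ / θ := fun i => div_nonneg (hb0 i) hθ.le
  have hc1 : ∀ i, min (a i) θ / θ ≤ 1 := fun i => (div_le_one hθ).2 (min_le_right _ _)
  have hA : 1 - ∏ i ∈ U, (1 - min (a i) θ) ≤ saleProb a U :=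
    sub_le_sub_left (Finset.prod_le_prod (fun i _ => by linarith [h1 i])
      fun i _ => by linarith [min_le_left (a i) θ]) 1
  have h2 := half_min_le_one_sub_prod hb0 hb1 U
  have h3 := one_sub_sum_le_prod hc0 hc1 U
  have h4 := prod_one_sub_nonneg hc1 U
  rw [← Finset.sum_div] at h3
  set s := ∑ i ∈ U, min (a i) θ
  have h5 : θ * (s / θ) = s := mul_div_cancel₀ _ hθ.ne'
  have h6 : θ / 2 * (1 - ∏ i ∈ U, (1 - min (a i) θ / θ)) ≤ s / 2 := by
    have := mul_le_mul_of_nonneg_left h3 hθ.le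
    linarith
  have h7 : θ / 2 * (1 - ∏ i ∈ U, (1 - min (a i) θ / θ)) ≤ θ / 2 := by
    have := mul_nonneg hθ.le h4
    linarith
  refine le_min ?_ (by linarith)
  refine le_trans ?_ (h2.trans hA)
  rw [le_div_iff₀ two_pos]
  exact le_min (by linarith) (by linarith)

end Weights

/-! ### The policy and the evolution of its stock -/

lemma measurable_update_prod {ι : Type*} [DecidableEq ι] {X : ι → Type*}
    [∀ i, MeasurableSpace (X i)] (i : ι) :
    Measurable fun p : (∀ j, X j) × X i => Function.update p.1 i p.2 := by
  refine measurable_pi_lambda _ fun j => ?_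
  rcases eq_or_ne j i with rfl | hj
  · simpa using measurable_snd
  · simp only [Function.update_of_ne hj]
    exact (measurable_pi_apply j).comp measurable_fst

/-- Resampling one coordinate does not change a product measure. -/
lemma infinitePi_map_update {ι : Type*} [DecidableEq ι] {X : ι → Type*}
    [∀ i, MeasurableSpace (X i)] (μ : ∀ i, Measure (X i)) [∀ i, IsProbabilityMeasure (μ i)]
    (i : ι) :
    ((Measure.infinitePi μ).prod (μ i)).map (fun p => Function.update p.1 i p.2) =
      Measure.infinitePi μ := by
  have hmeas := measurable_update_prod (X := X) i
  refine Measure.eq_infinitePi μ fun s t ht => ?_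
  rw [Measure.map_apply hmeas (MeasurableSet.pi s.countable_toSet fun j _ => ht j)]
  by_cases hi : i ∈ s
  · have hpre : (fun p : (∀ j, X j) × X i => Function.update p.1 i p.2) ⁻¹' Set.pi s t
        = Set.pi (s.erase i) t ×ˢ t i := by
      ext p
      simp only [Set.mem_preimage, Set.mem_pi, Set.mem_prod, Finset.coe_erase, Set.mem_sdiff,
        Finset.mem_coe, Set.mem_singleton_iff]
      constructor
      · intro h
        refine ⟨fun j hj => ?_, by simpa using h i hi⟩
        simpa [hj.2] using h j hj.1
      · rintro ⟨h1, h2⟩ j hj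
        rcases eq_or_ne j i with rfl | hji
        · simpa using h2
        · simpa [hji] using h1 j ⟨hj, hji⟩
    rw [hpre, Measure.prod_prod, Measure.infinitePi_pi _ fun j _ => ht j, mul_comm,
      Finset.mul_prod_erase s (fun j => μ j (t j)) hi]
  · have hpre : (fun p : (∀ j, X j) × X i => Function.update p.1 i p.2) ⁻¹' Set.pi s t
        = Set.pi s t ×ˢ Set.univ := by
      ext p
      simp only [Set.mem_preimage, Set.mem_pi, Set.mem_prod, Finset.mem_coe, Set.mem_univ,
        and_true]
      refine forall₂_congr fun j hj => ?_
      have hji : j ≠ i := by rintro rfl; exact hi hj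
      rw [Function.update_of_ne hji]
    rw [hpre, Measure.prod_prod, Measure.infinitePi_pi _ fun j _ => ht j, measure_univ, mul_one]

lemma lintegral_infinitePi_update {ι : Type*} [DecidableEq ι] {X : ι → Type*}
    [∀ i, MeasurableSpace (X i)] (μ : ∀ i, Measure (X i)) [∀ i, IsProbabilityMeasure (μ i)]
    (i : ι) {f : (∀ j, X j) → ℝ≥0∞} (hf : Measurable f) :
    ∫⁻ x, f x ∂Measure.infinitePi μ =
      ∫⁻ x, ∫⁻ y, f (Function.update x i y) ∂μ i ∂Measure.infinitePi μ := by
  have hmeas := measurable_update_prod (X := X) i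
  conv_lhs => rw [← infinitePi_map_update μ i]
  rw [lintegral_map hf hmeas]
  exact lintegral_prod _ (hf.comp hmeas).aemeasurable

/-- The private randomness of the seller: for each buyer and each set of items that may be on hand
when she arrives, an item to propose and an answer in case her value equals the price. -/
abbrev ChoiceTable (m : ℕ) : Type := ℕ → Finset (Fin m) → Fin m × Bool

/-- The data of a policy that aims at selling item `i` to buyer `t + 1` with probability `a t i`:
when `U` is on hand, it accepts buyer `t + 1` with probability `saleProb (a t) U`, by means of the
price `price t U` and of the probability `tie t U` of accepting a tie, and gives her item `i` with
probability `w t U i`. -/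
structure ThinningRule (m : ℕ) (V : Measure ℝ≥0) where
  a : ℕ → Fin m → ℝ
  w : ℕ → Finset (Fin m) → Fin m → ℝ
  price : ℕ → Finset (Fin m) → ℝ≥0
  tie : ℕ → Finset (Fin m) → ℝ
  a_nonneg : ∀ t i, 0 ≤ a t i
  a_le_one : ∀ t i, a t i ≤ 1
  w_nonneg : ∀ t U i, 0 ≤ w t U i
  sum_w : ∀ t U, ∑ i, w t U i = 1
  saleProb_mul_w : ∀ t U i, saleProb (a t) U * w t U i =
    if i ∈ U then a t i * ∏ j ∈ U with i < j, (1 - a t j) else 0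
  tie_nonneg : ∀ t U, 0 ≤ tie t U
  tie_le_one : ∀ t U, tie t U ≤ 1
  price_tie : ∀ t U, 0 < saleProb (a t) U →
    V.real (Set.Ioi (price t U)) + tie t U * V.real {price t U} = saleProb (a t) U

lemma exists_thinningRule {m : ℕ} (hm : 1 ≤ m) (V : Measure ℝ≥0) [IsProbabilityMeasure V]
    {a : ℕ → Fin m → ℝ} (h0 : ∀ t i, 0 ≤ a t i) (h1 : ∀ t i, a t i ≤ 1) :
    ∃ R : ThinningRule m V, R.a = a := by
  have : Nonempty (Fin m) := ⟨⟨0, hm⟩⟩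
  choose w hw0 hw1 hw using fun t U => exists_itemWeight (h0 t) (h1 t) U
  choose p k hk0 hk1 hk using fun t U => exists_price_tie V (saleProb_le_one (h1 t) U)
  exact ⟨⟨a, w, p, k, h0, h1, hw0, hw1, hw, hk0, hk1, hk⟩, rfl⟩

namespace ThinningRule

variable {m : ℕ} {V : Measure ℝ≥0} (R : ThinningRule m V)

noncomputable section

/-- The law of the item proposed to buyer `t + 1` when `U` is on hand. -/
def itemLaw (t : ℕ) (U : Finset (Fin m)) : Measure (Fin m) :=
  ∑ i, ENNReal.ofReal (R.w t U i) • Measure.dirac i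

/-- The law of the answer to a buyer `t + 1` whose value equals the price, when `U` is on hand. -/
def tieLaw (t : ℕ) (U : Finset (Fin m)) : Measure Bool :=
  ENNReal.ofReal (R.tie t U) • Measure.dirac true +
    ENNReal.ofReal (1 - R.tie t U) • Measure.dirac false

instance (t : ℕ) (U : Finset (Fin m)) : IsProbabilityMeasure (R.itemLaw t U) := by
  constructor
  simp only [itemLaw, Measure.finsetSum_apply, Measure.smul_apply, measure_univ, smul_eq_mul,
    mul_one]
  rw [← ENNReal.ofReal_sum_of_nonneg fun i _ => R.w_nonneg t U i, R.sum_w, ENNReal.ofReal_one]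

instance (t : ℕ) (U : Finset (Fin m)) : IsProbabilityMeasure (R.tieLaw t U) := by
  constructor
  simp only [tieLaw, Measure.add_apply, Measure.smul_apply, measure_univ, smul_eq_mul, mul_one]
  rw [← ENNReal.ofReal_add (R.tie_nonneg t U) (by linarith [R.tie_le_one t U]),
    add_sub_cancel, ENNReal.ofReal_one]

/-- The law of the random choices for buyer `t + 1`: one choice of an item and of an answer to a
tie for each set that may be on hand, all independent. -/
def tableLaw (t : ℕ) : Measure (Finset (Fin m) → Fin m × Bool) :=
  Measure.pi fun U => (R.itemLaw t U).prod (R.tieLaw t U)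

instance (t : ℕ) : IsProbabilityMeasure (R.tableLaw t) := by unfold tableLaw; infer_instance

/-- The items (at most one) sold to buyer `t + 1` of value `v` when `U` is on hand and the random
choice of an item and of an answer to a tie is `q`. -/
def sale (t : ℕ) (U : Finset (Fin m)) (q : Fin m × Bool) (v : ℝ≥0) : Finset (Fin m) :=
  if 0 < saleProb (R.a t) U ∧ q.1 ∈ U ∧
    (R.price t U < v ∨ R.price t U = v ∧ q.2 = true) then {q.1} else ∅

/-- The pricing policy with the given data; it uses the past only through the number of
buyers so far. -/
abbrev policy : PricingPolicy m where
  Seed := ChoiceTable m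
  seedLaw := Measure.infinitePi R.tableLaw
  item s I := if 0 < saleProb (R.a I.1.length) I.2 then some (s I.1.length I.2).1 else none
  price _ I := R.price I.1.length I.2
  tie s I := (s I.1.length I.2).2
  measurableSet_item I o := by
    have h : Measurable fun s : ChoiceTable m => (s I.1.length I.2).1 :=
      measurable_fst.comp ((measurable_pi_apply _).comp (measurable_pi_apply _))
    split_ifs with hA
    · rcases o with _ | i
      · simp
      · simp only [Option.some.injEq]
        exact h (measurableSet_singleton i)
    · exact MeasurableSet.const _
  measurable_price _ := measurable_const
  measurable_tie I :=
    measurable_snd.comp ((measurable_pi_apply _).comp (measurable_pi_apply _))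

/-- The items sold to the first `t` buyers. -/
def sold (s : ChoiceTable m) (h : Fin m → ℕ) (x : ℕ → ℝ≥0) :
    ℕ → Finset (Fin m)
  | 0 => ∅
  | t + 1 => sold s h x t ∪
      R.sale t (onHand h (sold s h x t) t) (s t (onHand h (sold s h x t) t)) (x t)

/-- The items on hand when buyer `t + 1` arrives. -/
def stock (s : ChoiceTable m) (h : Fin m → ℕ) (x : ℕ → ℝ≥0) (t : ℕ) :
    Finset (Fin m) := onHand h (R.sold s h x t) t

lemma toFinset_policy_sale (s : ChoiceTable m) (I : Info m) (v : ℝ≥0) :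
    (R.policy.sale s I v).toFinset = R.sale I.1.length I.2 (s I.1.length I.2) v := by
  unfold PricingPolicy.sale sale
  simp only
  by_cases hA : 0 < saleProb (R.a I.1.length) I.2
  · simp only [hA, if_true, true_and]
    split_ifs <;> simp
  · simp [hA]

lemma policy_state (s : ChoiceTable m) (h : Fin m → ℕ) (x : ℕ → ℝ≥0) (t : ℕ) :
    (R.policy.state s h x t).1.length = t ∧ (R.policy.state s h x t).2 = R.sold s h x t := by
  induction t with
  | zero => simp [PricingPolicy.state, sold]
  | succ t ih =>
    obtain ⟨ih1, ih2⟩ := ih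
    simp only [PricingPolicy.state, sold, List.length_cons, ih1, true_and]
    rw [toFinset_policy_sale]
    simp only [ih1, ih2]

lemma isSome_saleAt (s : ChoiceTable m) (h : Fin m → ℕ) (x : ℕ → ℝ≥0) (t : ℕ) :
    (R.policy.saleAt s h x t).isSome ↔
      (R.sale t (R.stock s h x t) (s t (R.stock s h x t)) (x t)).Nonempty := by
  have h1 := R.toFinset_policy_sale s ((R.policy.state s h x t).1,
    onHand h (R.policy.state s h x t).2 t) (x t)
  simp only [(R.policy_state s h x t).1, (R.policy_state s h x t).2] at h1
  unfold stock
  rw [← h1, ← (R.policy_state s h x t).2]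
  unfold PricingPolicy.saleAt
  cases R.policy.sale s ((R.policy.state s h x t).1,
    onHand h (R.policy.state s h x t).2 t) (x t) <;> simp

lemma measurable_sale (t : ℕ) (U : Finset (Fin m)) :
    Measurable fun z : (Fin m × Bool) × ℝ≥0 => R.sale t U z.1 z.2 := by
  unfold sale
  refine Measurable.ite ?_ ?_ measurable_const
  · refine (MeasurableSet.const _).inter (MeasurableSet.inter ?_ (MeasurableSet.union ?_ ?_))
    · exact (measurable_fst.comp measurable_fst) (MeasurableSet.of_discrete (s := {i | i ∈ U}))
    · exact measurable_snd measurableSet_Ioi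
    · refine MeasurableSet.inter ?_ ?_
      · exact measurableSet_eq_fun measurable_const measurable_snd
      · exact (measurable_snd.comp measurable_fst) (measurableSet_singleton true)
  · exact (Measurable.of_discrete (f := fun i : Fin m => ({i} : Finset (Fin m)))).comp
      (measurable_fst.comp measurable_fst)

/-- A quantity that depends on the stock, on the choice made for it, and on the value of the
buyer is measurable. -/
lemma measurable_at_stock {Ω β γ : Type*} [MeasurableSpace Ω] [MeasurableSpace β]
    [MeasurableSpace γ] {Z : Ω → Finset (Fin m)} {s : Ω → Finset (Fin m) → Fin m × Bool}
    {v : Ω → γ} (hZ : Measurable Z) (hs : Measurable s) (hv : Measurable v)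
    {Ψ : Finset (Fin m) → (Fin m × Bool) × γ → β} (hΨ : ∀ U, Measurable (Ψ U)) :
    Measurable fun ω => Ψ (Z ω) (s ω (Z ω), v ω) := by
  have h : Measurable fun z : Finset (Fin m) × Ω => Ψ z.1 (s z.2 z.1, v z.2) :=
    measurable_from_prod_countable_right fun U =>
      (hΨ U).comp (((measurable_pi_apply U).comp hs).prodMk hv)
  exact h.comp (hZ.prodMk measurable_id)

lemma measurable_sold (t : ℕ) :
    Measurable fun ω : ChoiceTable m × (Fin m → ℕ) × (ℕ → ℝ≥0) =>
      R.sold ω.1 ω.2.1 ω.2.2 t := by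
  induction t with
  | zero => exact measurable_const
  | succ t ih =>
    have hZ : Measurable fun ω : ChoiceTable m × (Fin m → ℕ) × (ℕ → ℝ≥0) =>
        onHand ω.2.1 (R.sold ω.1 ω.2.1 ω.2.2 t) t :=
      (Measurable.of_discrete (f := fun z : (Fin m → ℕ) × Finset (Fin m) =>
        onHand z.1 z.2 t)).comp (measurable_snd.fst.prodMk ih)
    have hS := measurable_at_stock hZ ((measurable_pi_apply t).comp measurable_fst)
      ((measurable_pi_apply t).comp measurable_snd.snd) (R.measurable_sale t)
    exact (Measurable.of_discrete (f := fun z : Finset (Fin m) × Finset (Fin m) =>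
        z.1 ∪ z.2)).comp (ih.prodMk hS)

lemma measurable_stock (t : ℕ) :
    Measurable fun ω : ChoiceTable m × (Fin m → ℕ) × (ℕ → ℝ≥0) =>
      R.stock ω.1 ω.2.1 ω.2.2 t :=
  (Measurable.of_discrete (f := fun z : (Fin m → ℕ) × Finset (Fin m) =>
    onHand z.1 z.2 t)).comp (measurable_snd.fst.prodMk (R.measurable_sold t))

lemma sold_congr {s s' : ChoiceTable m} (h : Fin m → ℕ) {x x' : ℕ → ℝ≥0}
    {t : ℕ} (hs : ∀ k < t, s k = s' k) (hx : ∀ k < t, x k = x' k) :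
    R.sold s h x t = R.sold s' h x' t := by
  induction t with
  | zero => rfl
  | succ t ih =>
    have := ih (fun k hk => hs k (by omega)) (fun k hk => hx k (by omega))
    simp only [sold, this, hs t (by omega), hx t (by omega)]

lemma stock_update (s : ChoiceTable m) (h : Fin m → ℕ) (x : ℕ → ℝ≥0) (t : ℕ)
    (r : Finset (Fin m) → Fin m × Bool) (v : ℝ≥0) :
    R.stock (Function.update s t r) h x t = R.stock s h x t ∧
      R.stock s h (Function.update x t v) t = R.stock s h x t := by
  unfold stock
  constructor
  · rw [R.sold_congr h (s' := s) (x' := x)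
      (fun k hk => Function.update_of_ne hk.ne _ _) fun _ _ => rfl]
  · rw [R.sold_congr h (s' := s) (x' := x) (fun _ _ => rfl)
      fun k hk => Function.update_of_ne hk.ne _ _]

/-- The choice made for buyer `t + 1` and her value are independent of the stock she meets. -/
lemma lintegral_at_stock [IsProbabilityMeasure V] (h : Fin m → ℕ) (t : ℕ)
    {Ψ : Finset (Fin m) → (Fin m × Bool) × ℝ≥0 → ℝ≥0∞} (hΨ : ∀ U, Measurable (Ψ U)) :
    ∫⁻ s, ∫⁻ x, Ψ (R.stock s h x t) (s t (R.stock s h x t), x t)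
        ∂(Measure.infinitePi fun _ : ℕ => V) ∂(Measure.infinitePi R.tableLaw) =
      ∫⁻ s, ∫⁻ x, (∫⁻ z, Ψ (R.stock s h x t) z
          ∂((R.itemLaw t (R.stock s h x t)).prod (R.tieLaw t (R.stock s h x t))).prod V)
        ∂(Measure.infinitePi fun _ : ℕ => V) ∂(Measure.infinitePi R.tableLaw) := by
  have hZ : Measurable fun z : ChoiceTable m × (ℕ → ℝ≥0) =>
      R.stock z.1 h z.2 t :=
    (R.measurable_stock t).comp (measurable_fst.prodMk (measurable_const.prodMk measurable_snd))
  have hfull : Measurable fun z : ChoiceTable m × (ℕ → ℝ≥0) =>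
      Ψ (R.stock z.1 h z.2 t) (z.1 t (R.stock z.1 h z.2 t), z.2 t) :=
    measurable_at_stock hZ ((measurable_pi_apply t).comp measurable_fst)
      ((measurable_pi_apply t).comp measurable_snd) hΨ
  set K : Finset (Fin m) → (Fin m × Bool) × ℝ≥0 → ℝ≥0∞ := fun U z => ∫⁻ v, Ψ U (z.1, v) ∂V with hK
  have hKm : ∀ U, Measurable (K U) := fun U =>
    (Measurable.lintegral_prod_right' (hΨ U)).comp measurable_fst
  have h1 : ∀ s : ChoiceTable m,
      ∫⁻ x, Ψ (R.stock s h x t) (s t (R.stock s h x t), x t)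
        ∂(Measure.infinitePi fun _ : ℕ => V) =
      ∫⁻ x, K (R.stock s h x t) (s t (R.stock s h x t), 0)
        ∂(Measure.infinitePi fun _ : ℕ => V) := by
    intro s
    rw [lintegral_infinitePi_update (fun _ : ℕ => V) t
      (f := fun x => Ψ (R.stock s h x t) (s t (R.stock s h x t), x t))
      (hfull.comp measurable_prodMk_left)]
    refine lintegral_congr fun x => lintegral_congr fun v => ?_
    rw [(R.stock_update s h x t (s t) v).2, Function.update_self]
  simp_rw [h1]
  have hKfull : Measurable fun z : ChoiceTable m × (ℕ → ℝ≥0) =>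
      K (R.stock z.1 h z.2 t) (z.1 t (R.stock z.1 h z.2 t), 0) :=
    measurable_at_stock hZ ((measurable_pi_apply t).comp measurable_fst) measurable_const hKm
  rw [lintegral_infinitePi_update R.tableLaw t
    (f := fun s => ∫⁻ x, K (R.stock s h x t) (s t (R.stock s h x t), 0)
        ∂(Measure.infinitePi fun _ : ℕ => V)) hKfull.lintegral_prod_right']
  refine lintegral_congr fun s => ?_
  have h2 : ∀ (r : Finset (Fin m) → Fin m × Bool) (x : ℕ → ℝ≥0),
      K (R.stock (Function.update s t r) h x t)
        (Function.update s t r t (R.stock (Function.update s t r) h x t), 0)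
      = K (R.stock s h x t) (r (R.stock s h x t), 0) := fun r x => by
    rw [(R.stock_update s h x t r 0).1, Function.update_self]
  simp_rw [h2]
  rw [lintegral_lintegral_swap]
  · refine lintegral_congr fun x => ?_
    set U := R.stock s h x t
    have h3 := (measurePreserving_eval (fun U => (R.itemLaw t U).prod (R.tieLaw t U)) U)
    have h4 : Measurable fun q : Fin m × Bool => K U (q, 0) := .of_discrete
    rw [lintegral_prod _ (hΨ U).aemeasurable]
    exact h3.lintegral_comp h4
  · exact (measurable_at_stock (Ω := (Finset (Fin m) → Fin m × Bool) × (ℕ → ℝ≥0))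
      (hZ.comp (measurable_const.prodMk measurable_snd)) measurable_fst measurable_const
      hKm).aemeasurable

/-- The answers to a tie and the values that lead to a purchase when `U` is on hand. -/
def acceptSet (t : ℕ) (U : Finset (Fin m)) : Set (Bool × ℝ≥0) :=
  {z | R.price t U < z.2 ∨ R.price t U = z.2 ∧ z.1 = true}

lemma acceptSet_eq (t : ℕ) (U : Finset (Fin m)) :
    R.acceptSet t U = Set.univ ×ˢ Set.Ioi (R.price t U) ∪ {true} ×ˢ {R.price t U} := by
  ext ⟨b, v⟩
  simp [acceptSet, and_comm, or_comm, eq_comm (a := R.price t U)]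

lemma measurableSet_acceptSet (t : ℕ) (U : Finset (Fin m)) : MeasurableSet (R.acceptSet t U) := by
  rw [acceptSet_eq]
  exact (MeasurableSet.univ.prod measurableSet_Ioi).union
    ((measurableSet_singleton _).prod (measurableSet_singleton _))

lemma measure_acceptSet [IsProbabilityMeasure V] {t : ℕ} {U : Finset (Fin m)} (hA :
    0 < saleProb (R.a t) U) :
    ((R.tieLaw t U).prod V) (R.acceptSet t U) = ENNReal.ofReal (saleProb (R.a t) U) := by
  have htrue : R.tieLaw t U {true} = ENNReal.ofReal (R.tie t U) := by simp [tieLaw]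
  rw [acceptSet_eq, measure_union _
    ((measurableSet_singleton _).prod (measurableSet_singleton _)), Measure.prod_prod,
    Measure.prod_prod, htrue, measure_univ, one_mul, ← R.price_tie t U hA,
    ENNReal.ofReal_add measureReal_nonneg (mul_nonneg (R.tie_nonneg t U) measureReal_nonneg),
    ENNReal.ofReal_mul (R.tie_nonneg t U), ofReal_measureReal, ofReal_measureReal]
  rw [Set.disjoint_left]
  rintro ⟨b, v⟩ h1 h2
  simp only [Set.mem_prod, Set.mem_univ, Set.mem_Ioi, true_and, Set.mem_singleton_iff] at h1 h2
  exact h1.ne' h2.2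

/-- The buyers accepted are those of highest value. -/
lemma le_measure_acceptSet_inter [IsProbabilityMeasure V] {t : ℕ} {U : Finset (Fin m)} (hA :
    0 < saleProb (R.a t) U)
    (v : ℝ≥0) :
    ENNReal.ofReal (min (saleProb (R.a t) U) (V.real (Set.Ioi v))) ≤
      ((R.tieLaw t U).prod V) (R.acceptSet t U ∩ Set.univ ×ˢ Set.Ioi v) := by
  rcases lt_or_ge v (R.price t U) with hv | hv
  · rw [Set.inter_eq_self_of_subset_left, R.measure_acceptSet hA]
    · exact ENNReal.ofReal_le_ofReal (min_le_left _ _)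
    · rintro z (hz | hz)
      · exact ⟨trivial, hv.trans hz⟩
      · exact ⟨trivial, hz.1 ▸ hv⟩
  · rw [Set.inter_eq_self_of_subset_right, Measure.prod_prod, measure_univ, one_mul,
      ← ofReal_measureReal (μ := V) (s := Set.Ioi v)]
    · exact ENNReal.ofReal_le_ofReal (min_le_right _ _)
    · rintro z ⟨-, hz⟩
      exact Or.inl (hv.trans_lt hz)

lemma w_eq_zero {t : ℕ} {U : Finset (Fin m)} (hA : 0 < saleProb (R.a t) U) {i : Fin m}
    (hi : i ∉ U) : R.w t U i = 0 := by
  have := R.saleProb_mul_w t U i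
  rw [if_neg hi] at this
  exact (mul_eq_zero.1 this).resolve_left hA.ne'

/-- The expectation of a function of the proposed item, the answer to a tie and the value is an
average over the proposed items. -/
lemma lintegral_choice [IsProbabilityMeasure V] (t : ℕ) (U : Finset (Fin m)) {F :
    (Fin m × Bool) × ℝ≥0 → ℝ≥0∞}
    (hF : Measurable F) :
    ∫⁻ z, F z ∂((R.itemLaw t U).prod (R.tieLaw t U)).prod V =
      ∑ i, ENNReal.ofReal (R.w t U i) *
        ∫⁻ y, F ((i, y.1), y.2) ∂(R.tieLaw t U).prod V := by
  rw [lintegral_prod _ hF.aemeasurable, lintegral_prod _ hF.lintegral_prod_right'.aemeasurable]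
  rw [itemLaw, lintegral_finsetSum_measure]
  refine Finset.sum_congr rfl fun i _ => ?_
  have hm : Measurable fun y : Bool × ℝ≥0 => F ((i, y.1), y.2) :=
    hF.comp ((measurable_const.prodMk measurable_fst).prodMk measurable_snd)
  rw [lintegral_smul_measure, lintegral_dirac, lintegral_prod _ hm.aemeasurable, smul_eq_mul]

/-- The indicator that a buyer `t + 1`, who meets the stock `U`, has a value above `v` and gets an
item. -/
def servedIndicator (v : ℝ≥0) (t : ℕ) (U : Finset (Fin m)) (z : (Fin m × Bool) × ℝ≥0) : ℝ≥0∞ :=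
  if (R.sale t U z.1 z.2).Nonempty ∧ v < z.2 then 1 else 0

lemma measurable_servedIndicator (t : ℕ) (U : Finset (Fin m)) :
    Measurable fun z : ((Fin m × Bool) × ℝ≥0) × ℝ≥0 => R.servedIndicator z.2 t U z.1 := by
  have h1 : MeasurableSet {z : ((Fin m × Bool) × ℝ≥0) × ℝ≥0 |
      (R.sale t U z.1.1 z.1.2).Nonempty} :=
    ((R.measurable_sale t U).comp measurable_fst) (MeasurableSet.of_discrete
      (s := {S : Finset (Fin m) | S.Nonempty}))
  have h2 : MeasurableSet {z : ((Fin m × Bool) × ℝ≥0) × ℝ≥0 | z.2 < z.1.2} :=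
    measurableSet_lt measurable_snd measurable_fst.snd
  exact Measurable.ite (h1.inter h2) measurable_const measurable_const

/-- The indicator that buyer `t + 1` has a value above `v` and gets an item. -/
def served (v : ℝ≥0) (t : ℕ) (s : ChoiceTable m) (h : Fin m → ℕ) (x : ℕ → ℝ≥0) : ℝ≥0∞ :=
  R.servedIndicator v t (R.stock s h x t) (s t (R.stock s h x t), x t)

lemma le_lintegral_servedIndicator [IsProbabilityMeasure V] (t : ℕ) (U : Finset (Fin m))
    (v : ℝ≥0) :
    ENNReal.ofReal (min (saleProb (R.a t) U) (V.real (Set.Ioi v))) ≤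
      ∫⁻ z, R.servedIndicator v t U z ∂((R.itemLaw t U).prod (R.tieLaw t U)).prod V := by
  rcases le_or_gt (saleProb (R.a t) U) 0 with hA | hA
  · rw [ENNReal.ofReal_eq_zero.2 ((min_le_left _ _).trans hA)]
    exact zero_le
  have hmeas : Measurable (R.servedIndicator v t U) :=
    (R.measurable_servedIndicator t U).comp measurable_prodMk_right
  rw [R.lintegral_choice t U hmeas]
  have hterm : ∀ i, ENNReal.ofReal (R.w t U i) *
      ENNReal.ofReal (min (saleProb (R.a t) U) (V.real (Set.Ioi v))) ≤
      ENNReal.ofReal (R.w t U i) * ∫⁻ y, R.servedIndicator v t U ((i, y.1), y.2)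
        ∂(R.tieLaw t U).prod V := by
    intro i
    by_cases hi : i ∈ U
    · refine mul_le_mul_right ((R.le_measure_acceptSet_inter hA v).trans ?_) _
      rw [← lintegral_indicator_one ((R.measurableSet_acceptSet t U).inter
        (MeasurableSet.univ.prod measurableSet_Ioi))]
      refine lintegral_mono fun y => ?_
      by_cases hy : y ∈ R.acceptSet t U ∩ Set.univ ×ˢ Set.Ioi v
      · rw [Set.indicator_of_mem hy, servedIndicator, if_pos]
        · exact le_rfl
        · refine ⟨?_, hy.2.2⟩
          unfold sale
          rw [if_pos ⟨hA, hi, hy.1⟩]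
          exact Finset.singleton_nonempty _
      · rw [Set.indicator_of_notMem hy]
        exact zero_le
    · simp [R.w_eq_zero hA hi]
  refine le_trans (le_of_eq ?_) (Finset.sum_le_sum fun i _ => hterm i)
  rw [← Finset.sum_mul, ← ENNReal.ofReal_sum_of_nonneg fun i _ => R.w_nonneg t U i, R.sum_w,
    ENNReal.ofReal_one, one_mul]

lemma lintegral_prod_sale_le [IsProbabilityMeasure V] (t : ℕ) (U : Finset (Fin m))
    {c : Fin m → ℝ} (hc0 : ∀ i, 0 ≤ c i) (hc1 : ∀ i, c i ≤ 1) :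
    ∫⁻ z, ENNReal.ofReal (∏ j ∈ U \ R.sale t U z.1 z.2, (1 - c j))
        ∂((R.itemLaw t U).prod (R.tieLaw t U)).prod V ≤
      ENNReal.ofReal (∏ j ∈ U, (1 - (1 - R.a t j) * c j)) := by
  rcases le_or_gt (saleProb (R.a t) U) 0 with hA | hA
  · have hs : ∀ z : (Fin m × Bool) × ℝ≥0, R.sale t U z.1 z.2 = ∅ := fun z => by
      simp [sale, hA.not_gt]
    simp only [hs, Finset.sdiff_empty, lintegral_const, measure_univ, mul_one]
    refine ENNReal.ofReal_le_ofReal (Finset.prod_le_prod (fun j _ => by linarith [hc1 j])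
      fun j _ => ?_)
    nlinarith [mul_nonneg (R.a_nonneg t j) (hc0 j)]
  set A := saleProb (R.a t) U with hAdef
  have hA1 : A ≤ 1 := saleProb_le_one (R.a_le_one t) U
  have hQ : ∀ S : Finset (Fin m), 0 ≤ ∏ j ∈ S, (1 - c j) := prod_one_sub_nonneg hc1
  have hmeas : Measurable fun z : (Fin m × Bool) × ℝ≥0 =>
      ENNReal.ofReal (∏ j ∈ U \ R.sale t U z.1 z.2, (1 - c j)) :=
    (Measurable.of_discrete (f := fun S : Finset (Fin m) =>
      ENNReal.ofReal (∏ j ∈ U \ S, (1 - c j)))).comp (R.measurable_sale t U)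
  rw [R.lintegral_choice t U hmeas]
  have hterm : ∀ i, ENNReal.ofReal (R.w t U i) * ∫⁻ y : Bool × ℝ≥0,
        ENNReal.ofReal (∏ j ∈ U \ R.sale t U (i, y.1) y.2, (1 - c j))
          ∂(R.tieLaw t U).prod V =
      ENNReal.ofReal (R.w t U i * (A * ∏ j ∈ U.erase i, (1 - c j) +
        (1 - A) * ∏ j ∈ U, (1 - c j))) := by
    intro i
    by_cases hi : i ∈ U
    · have hy : ∀ y : Bool × ℝ≥0,
          ENNReal.ofReal (∏ j ∈ U \ R.sale t U (i, y.1) y.2, (1 - c j)) =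
          (R.acceptSet t U).indicator
              (fun _ => ENNReal.ofReal (∏ j ∈ U.erase i, (1 - c j))) y +
            (R.acceptSet t U)ᶜ.indicator (fun _ => ENNReal.ofReal (∏ j ∈ U, (1 - c j))) y := by
        intro y
        unfold sale
        by_cases hacc : y ∈ R.acceptSet t U
        · rw [if_pos ⟨hA, hi, hacc⟩, Set.indicator_of_mem hacc,
            Set.indicator_of_notMem (by simpa using hacc), add_zero, Finset.sdiff_singleton_eq_erase]
        · rw [if_neg fun h => hacc h.2.2, Set.indicator_of_notMem hacc,
            Set.indicator_of_mem (by simpa using hacc), zero_add, Finset.sdiff_empty]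
      simp_rw [hy]
      rw [lintegral_add_left (measurable_const.indicator (R.measurableSet_acceptSet t U)),
        lintegral_indicator_const (R.measurableSet_acceptSet t U),
        lintegral_indicator_const (R.measurableSet_acceptSet t U).compl,
        prob_compl_eq_one_sub (R.measurableSet_acceptSet t U), R.measure_acceptSet hA,
        ← ENNReal.ofReal_one, ← ENNReal.ofReal_sub 1 hA.le, ← ENNReal.ofReal_mul (hQ _),
        ← ENNReal.ofReal_mul (hQ _), ← ENNReal.ofReal_add (mul_nonneg (hQ _) hA.le)
          (mul_nonneg (hQ _) (sub_nonneg.2 hA1)), ← ENNReal.ofReal_mul (R.w_nonneg t U i)]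
      congr 1
      ring
    · simp [R.w_eq_zero hA hi]
  simp_rw [hterm]
  rw [← ENNReal.ofReal_sum_of_nonneg fun i _ => mul_nonneg (R.w_nonneg t U i)
    (add_nonneg (mul_nonneg hA.le (hQ _)) (mul_nonneg (sub_nonneg.2 hA1) (hQ _)))]
  refine ENNReal.ofReal_le_ofReal (le_trans (le_of_eq ?_) (prod_one_sub_step_le (R.a_nonneg t)
    (R.a_le_one t) hc0 hc1 U (R.saleProb_mul_w t U)))
  have h1 : ∀ i, R.w t U i * (A * ∏ j ∈ U.erase i, (1 - c j) + (1 - A) * ∏ j ∈ U, (1 - c j)) =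
      A * R.w t U i * ∏ j ∈ U.erase i, (1 - c j) +
        R.w t U i * ((1 - A) * ∏ j ∈ U, (1 - c j)) := fun i => by ring
  simp_rw [h1]
  rw [Finset.sum_add_distrib, ← Finset.sum_mul, R.sum_w, one_mul, add_comm]

/-- The stock is at least as good as if each item were removed with probability `a t i` at each
time `t`, independently of everything else, when sets `U` are compared by
`∏ i ∈ U, (1 - c i)`. -/
lemma lintegral_prod_stock_le [IsProbabilityMeasure V] (h : Fin m → ℕ) (t : ℕ)
    {c : Fin m → ℝ} (hc0 : ∀ i, 0 ≤ c i) (hc1 : ∀ i, c i ≤ 1) :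
    ∫⁻ s, ∫⁻ x, ENNReal.ofReal (∏ i ∈ R.stock s h x t, (1 - c i))
        ∂(Measure.infinitePi fun _ : ℕ => V) ∂(Measure.infinitePi R.tableLaw) ≤
      ENNReal.ofReal (∏ i, (1 - c i * (∏ k ∈ Finset.range t, (1 - R.a k i)) *
        if t + 1 ≤ h i then 1 else 0)) := by
  induction t generalizing c with
  | zero =>
    have hz : ∀ (s : ChoiceTable m) (x : ℕ → ℝ≥0), ∏ i ∈ R.stock s h x 0, (1 - c i) =
        ∏ i, (1 - c i * (∏ k ∈ Finset.range 0, (1 - R.a k i)) *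
          if 0 + 1 ≤ h i then 1 else 0) := by
      intro s x
      simp only [stock, onHand, sold, Finset.notMem_empty, not_false_eq_true, true_and,
        Finset.prod_filter, Finset.range_zero, Finset.prod_empty, mul_one]
      refine Finset.prod_congr rfl fun i _ => ?_
      split_ifs <;> simp
    simp only [hz, lintegral_const, measure_univ, mul_one, le_refl]
  | succ t ih =>
    set c' : Fin m → ℝ := fun i => c i * if t + 1 + 1 ≤ h i then 1 else 0 with hc'
    have hc0' : ∀ i, 0 ≤ c' i := fun i => by
      simp only [hc']; split_ifs <;> simp [hc0 i]
    have hc1' : ∀ i, c' i ≤ 1 := fun i => by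
      simp only [hc']; split_ifs <;> simp [hc1 i]
    have hstep : ∀ (s : ChoiceTable m) (x : ℕ → ℝ≥0),
        ∏ i ∈ R.stock s h x (t + 1), (1 - c i) =
        ∏ i ∈ R.stock s h x t \
          R.sale t (R.stock s h x t) (s t (R.stock s h x t)) (x t), (1 - c' i) := by
      intro s x
      have hset : R.stock s h x (t + 1) = (R.stock s h x t \
          R.sale t (R.stock s h x t) (s t (R.stock s h x t)) (x t)).filter
            fun i => t + 1 + 1 ≤ h i := by
        ext i
        simp only [stock, sold, onHand, Finset.mem_filter, Finset.mem_univ, true_and,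
          Finset.mem_union, Finset.mem_sdiff, not_or]
        constructor
        · rintro ⟨⟨h1, h2⟩, h3⟩
          exact ⟨⟨⟨h1, by omega⟩, h2⟩, h3⟩
        · rintro ⟨⟨⟨h1, -⟩, h2⟩, h3⟩
          exact ⟨⟨h1, h2⟩, h3⟩
      rw [hset, Finset.prod_filter]
      refine Finset.prod_congr rfl fun i _ => ?_
      simp only [hc']
      split_ifs <;> simp
    simp_rw [hstep]
    rw [R.lintegral_at_stock h t (Ψ := fun U z =>
      ENNReal.ofReal (∏ i ∈ U \ R.sale t U z.1 z.2, (1 - c' i))) fun U =>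
        (Measurable.of_discrete (f := fun S : Finset (Fin m) =>
          ENNReal.ofReal (∏ j ∈ U \ S, (1 - c' j)))).comp (R.measurable_sale t U)]
    refine (lintegral_mono fun s => lintegral_mono fun x =>
      R.lintegral_prod_sale_le t (R.stock s h x t) hc0' hc1').trans ?_
    have ha0 := R.a_nonneg t
    have ha1 := R.a_le_one t
    refine (ih (c := fun i => (1 - R.a t i) * c' i)
      (fun i => mul_nonneg (sub_nonneg.2 (ha1 i)) (hc0' i))
      (fun i => mul_le_one₀ (by linarith [ha0 i]) (hc0' i) (hc1' i))).trans (le_of_eq ?_)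
    congr 1
    refine Finset.prod_congr rfl fun i _ => ?_
    simp only [hc', Finset.prod_range_succ]
    by_cases h1 : t + 1 + 1 ≤ h i
    · rw [if_pos h1, if_pos (by omega)]
      ring
    · rw [if_neg h1]
      ring

end

end ThinningRule

/-! ### Welfare of the policy at a level -/

/-- The rate at which the policy aims at selling an item with tail function `f` at time `t`: the
inverse of its mean residual life. -/
noncomputable def inverseResidualLife (f : ℕ → ℝ) (t : ℕ) : ℝ := f t / tailSum f t

namespace IsMHRTail

variable {f : ℕ → ℝ}

lemma inverseResidualLife_nonneg (hf : IsMHRTail f) (t : ℕ) : 0 ≤ inverseResidualLife f t :=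
  div_nonneg (hf.nonneg t) (hf.tailSum_nonneg t)

lemma inverseResidualLife_le_one (hf : IsMHRTail f) (t : ℕ) : inverseResidualLife f t ≤ 1 :=
  div_le_one_of_le₀ (hf.le_tailSum t) (hf.tailSum_nonneg t)

/-- Removing the item at the rate `inverseResidualLife f` makes its life have the equilibrium
distribution of `f`. -/
lemma prod_one_sub_inverseResidualLife (hf : IsMHRTail f) (t : ℕ) :
    ∏ k ∈ Finset.range t, (1 - inverseResidualLife f k) = tailSum f t / tailSum f 0 := by
  induction t with
  | zero => simp [div_self (one_pos.trans_le hf.one_le_tailSum_zero).ne']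
  | succ t ih =>
    rw [Finset.prod_range_succ, ih, inverseResidualLife]
    have h1 := hf.tailSum_eq_add t
    rcases (hf.tailSum_nonneg t).eq_or_lt with h | h
    · have h2 := hf.tailSum_nonneg (t + 1)
      have h3 := hf.nonneg t
      have h4 : tailSum f (t + 1) = 0 := by linarith
      rw [← h, h4]; simp
    · rw [show tailSum f (t + 1) = tailSum f t - f t by linarith]
      field_simp

lemma min_inverseResidualLife_mul (hf : IsMHRTail f) (θ : ℝ) (t : ℕ) :
    min (inverseResidualLife f t) θ / θ * (tailSum f t / tailSum f 0) * f t =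
      saleRate f θ t / θ := by
  unfold inverseResidualLife saleRate
  rcases (hf.nonneg t).eq_or_lt with h | h
  · rw [← h]; simp
  · have hG := hf.tailSum_pos h
    have : min (f t) (θ * tailSum f t) = min (f t / tailSum f t) θ * tailSum f t := by
      rw [min_mul_of_nonneg _ _ hG.le, div_mul_cancel₀ _ hG.ne']
    rw [this]
    ring

lemma saleRate_le (hf : IsMHRTail f) {θ : ℝ} (hθ : 0 ≤ θ) (t : ℕ) : saleRate f θ t ≤ θ := by
  have hμ : 0 < tailSum f 0 := one_pos.trans_le hf.one_le_tailSum_zero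
  have h1 : f t ≤ 1 := hf.zero ▸ hf.antitone (Nat.zero_le t)
  unfold saleRate
  calc f t / tailSum f 0 * min (f t) (θ * tailSum f t)
      ≤ 1 / tailSum f 0 * (θ * tailSum f 0) := by
        refine mul_le_mul (div_le_div_of_nonneg_right h1 hμ.le) ((min_le_right _ _).trans
          (mul_le_mul_of_nonneg_left (hf.tailSum_antitone (Nat.zero_le t)) hθ))
          (le_min (hf.nonneg _) (mul_nonneg hθ (hf.tailSum_nonneg _))) (by positivity)
    _ = θ := by field_simp

end IsMHRTail

/-- A measure for which the values below `x` have mass `x`, as used in the layer-cake formula. -/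
lemma exists_layer_measure :
    ∃ l : Measure ℝ≥0, SFinite l ∧ ∀ x : ℝ≥0, l (Set.Iio x) = x := by
  refine ⟨(volume.restrict (Set.Ioi (0 : ℝ))).map Real.toNNReal, inferInstance, fun x => ?_⟩
  have h : Real.toNNReal ⁻¹' Set.Iio x ∩ Set.Ioi (0 : ℝ) = Set.Ioo 0 (x : ℝ) := by
    ext r
    simp only [Set.mem_inter_iff, Set.mem_preimage, Set.mem_Iio, Set.mem_Ioi, Set.mem_Ioo]
    constructor
    · rintro ⟨h1, h2⟩
      exact ⟨h2, (Real.toNNReal_lt_iff_lt_coe h2.le).1 h1⟩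
    · rintro ⟨h1, h2⟩
      exact ⟨(Real.toNNReal_lt_iff_lt_coe h1.le).2 h2, h1⟩
  rw [Measure.map_apply measurable_real_toNNReal measurableSet_Iio,
    Measure.restrict_apply (measurable_real_toNNReal measurableSet_Iio), h, Real.volume_Ioo,
    sub_zero, ENNReal.ofReal_coe_nnreal]

lemma lintegral_prod_prod_swap {α β γ : Type*} [MeasurableSpace α] [MeasurableSpace β]
    [MeasurableSpace γ] (μ : Measure α) (ν : Measure β) (κ : Measure γ) [SFinite μ] [SFinite ν]
    [SFinite κ] {F : α × β × γ → ℝ≥0∞} (hF : Measurable F) :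
    ∫⁻ ω, F ω ∂(μ.prod (ν.prod κ)) = ∫⁻ b, ∫⁻ a, ∫⁻ c, F (a, b, c) ∂κ ∂μ ∂ν := by
  have h2 : Measurable fun z : (α × β) × γ => F (z.1.1, z.1.2, z.2) :=
    hF.comp (measurable_fst.fst.prodMk (measurable_fst.snd.prodMk measurable_snd))
  have h3 : ∀ a, ∫⁻ y, F (a, y) ∂(ν.prod κ) = ∫⁻ b, ∫⁻ c, F (a, b, c) ∂κ ∂ν := fun a =>
    lintegral_prod _ (hF.comp measurable_prodMk_left).aemeasurable
  rw [lintegral_prod _ hF.aemeasurable]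
  simp_rw [h3]
  exact lintegral_lintegral_swap h2.lintegral_prod_right'.aemeasurable

/-- The average of a product over the items, when the horizons are independent. -/
lemma lintegral_one_sub_prod_horizon {m : ℕ} (H : Fin m → Measure ℕ)
    [∀ i, IsProbabilityMeasure (H i)] {d : Fin m → ℝ} (hd0 : ∀ i, 0 ≤ d i) (hd1 : ∀ i, d i ≤ 1)
    (t : ℕ) :
    ∫⁻ h, ENNReal.ofReal (1 - ∏ i, (1 - d i * if t + 1 ≤ h i then 1 else 0)) ∂Measure.pi H =
      ENNReal.ofReal (1 - ∏ i, (1 - d i * (H i).real (Set.Ici (t + 1)))) := by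
  have hle : ∀ h : Fin m → ℕ, 0 ≤ ∏ i, (1 - d i * if t + 1 ≤ h i then (1 : ℝ) else 0) ∧
      ∏ i, (1 - d i * if t + 1 ≤ h i then (1 : ℝ) else 0) ≤ 1 := fun h => by
    constructor
    · refine prod_one_sub_nonneg (fun i => ?_) _
      split_ifs <;> simp [hd1 i]
    · refine prod_one_sub_le_one (fun i => ?_) (fun i => ?_) _
      · split_ifs <;> simp [hd0 i]
      · split_ifs <;> simp [hd1 i]
  have hint : Integrable (fun h : Fin m → ℕ =>
      ∏ i, (1 - d i * if t + 1 ≤ h i then (1 : ℝ) else 0)) (Measure.pi H) :=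
    Integrable.of_bound (Measurable.of_discrete).aestronglyMeasurable 1
      (Filter.Eventually.of_forall fun h => by
        rw [Real.norm_of_nonneg (hle h).1]; exact (hle h).2)
  have hint' : Integrable (fun h : Fin m → ℕ =>
      1 - ∏ i, (1 - d i * if t + 1 ≤ h i then (1 : ℝ) else 0)) (Measure.pi H) :=
    (integrable_const 1).sub hint
  rw [← ofReal_integral_eq_lintegral_ofReal hint'
    (Filter.Eventually.of_forall fun h => sub_nonneg.2 (hle h).2),
    integral_sub (integrable_const 1) hint,
    integral_fintype_prod_eq_prod (fun i (n : ℕ) => 1 - d i * if t + 1 ≤ n then (1 : ℝ) else 0)]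
  simp only [integral_const, probReal_univ, smul_eq_mul, mul_one]
  congr 2
  refine Finset.prod_congr rfl fun i _ => ?_
  have hind : (fun n : ℕ => if t + 1 ≤ n then (1 : ℝ) else 0) =
      (Set.Ici (t + 1)).indicator 1 := by
    ext n
    simp [Set.indicator_apply]
  have hi : Integrable (fun n : ℕ => if t + 1 ≤ n then (1 : ℝ) else 0) (H i) := by
    rw [hind]
    exact (integrable_const 1).indicator measurableSet_Ici
  rw [integral_sub (integrable_const 1) (hi.const_mul _), integral_const_mul, hind,
    integral_indicator_one measurableSet_Ici]
  simp

namespace ThinningRule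

variable {m : ℕ} {V : Measure ℝ≥0} (R : ThinningRule m V)

lemma measurable_served (t : ℕ) :
    Measurable fun z : (ChoiceTable m × (Fin m → ℕ) × (ℕ → ℝ≥0)) × ℝ≥0 =>
      R.served z.2 t z.1.1 z.1.2.1 z.1.2.2 := by
  have hΨ : ∀ U, Measurable fun y : (Fin m × Bool) × ℝ≥0 × ℝ≥0 =>
      R.servedIndicator y.2.2 t U (y.1, y.2.1) := fun U => by
    have h1 : Measurable fun y : (Fin m × Bool) × ℝ≥0 × ℝ≥0 => ((y.1, y.2.1), y.2.2) :=
      (measurable_fst.prodMk measurable_snd.fst).prodMk measurable_snd.snd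
    have h2 := (R.measurable_servedIndicator t U).comp h1
    exact h2
  have hZ : Measurable fun z : (ChoiceTable m × (Fin m → ℕ) × (ℕ → ℝ≥0)) × ℝ≥0 =>
      R.stock z.1.1 z.1.2.1 z.1.2.2 t := (R.measurable_stock t).comp measurable_fst
  have hs : Measurable fun z : (ChoiceTable m × (Fin m → ℕ) × (ℕ → ℝ≥0)) × ℝ≥0 => z.1.1 t :=
    (measurable_pi_apply t).comp measurable_fst.fst
  have hx : Measurable fun z : (ChoiceTable m × (Fin m → ℕ) × (ℕ → ℝ≥0)) × ℝ≥0 =>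
      (z.1.2.2 t, z.2) :=
    ((measurable_pi_apply t).comp measurable_fst.snd.snd).prodMk measurable_snd
  exact measurable_at_stock hZ hs hx hΨ

lemma measurable_served_left (v : ℝ≥0) (t : ℕ) :
    Measurable fun ω : ChoiceTable m × (Fin m → ℕ) × (ℕ → ℝ≥0) =>
      R.served v t ω.1 ω.2.1 ω.2.2 := by
  have h1 : Measurable fun ω : ChoiceTable m × (Fin m → ℕ) × (ℕ → ℝ≥0) => (ω, v) :=
    measurable_prodMk_right
  have h2 := (R.measurable_served t).comp h1
  exact h2

lemma ofReal_one_sub_le_lintegral_stock [IsProbabilityMeasure V] (h : Fin m → ℕ) (t : ℕ)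
    {c : Fin m → ℝ} (hc0 : ∀ i, 0 ≤ c i) (hc1 : ∀ i, c i ≤ 1) :
    ENNReal.ofReal (1 - ∏ i, (1 - c i * (∏ k ∈ Finset.range t, (1 - R.a k i)) *
        if t + 1 ≤ h i then 1 else 0)) ≤
      ∫⁻ s, ∫⁻ x, ENNReal.ofReal (1 - ∏ i ∈ R.stock s h x t, (1 - c i))
        ∂(Measure.infinitePi fun _ : ℕ => V) ∂(Measure.infinitePi R.tableLaw) := by
  have hZ : Measurable fun z : ChoiceTable m × (ℕ → ℝ≥0) => R.stock z.1 h z.2 t :=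
    (R.measurable_stock t).comp (measurable_fst.prodMk (measurable_const.prodMk measurable_snd))
  have hm1 : Measurable fun z : ChoiceTable m × (ℕ → ℝ≥0) =>
      ENNReal.ofReal (1 - ∏ i ∈ R.stock z.1 h z.2 t, (1 - c i)) :=
    (Measurable.of_discrete (f := fun S : Finset (Fin m) =>
      ENNReal.ofReal (1 - ∏ i ∈ S, (1 - c i)))).comp hZ
  have hP := R.lintegral_prod_stock_le h t hc0 hc1
  have hP0 : 0 ≤ ∏ i, (1 - c i * (∏ k ∈ Finset.range t, (1 - R.a k i)) *
      if t + 1 ≤ h i then 1 else 0) := by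
    refine prod_one_sub_nonneg (fun i => ?_) _
    have h3 := prod_one_sub_nonneg (fun k => R.a_le_one k i) (Finset.range t)
    have h4 := prod_one_sub_le_one (fun k => R.a_nonneg k i) (fun k => R.a_le_one k i)
      (Finset.range t)
    have h5 := mul_le_one₀ (hc1 i) h3 h4
    split_ifs <;> simp [h5]
  have hone : ∫⁻ s, ∫⁻ x, ENNReal.ofReal (1 - ∏ i ∈ R.stock s h x t, (1 - c i))
        ∂(Measure.infinitePi fun _ : ℕ => V) ∂(Measure.infinitePi R.tableLaw) +
      ∫⁻ s, ∫⁻ x, ENNReal.ofReal (∏ i ∈ R.stock s h x t, (1 - c i))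
        ∂(Measure.infinitePi fun _ : ℕ => V) ∂(Measure.infinitePi R.tableLaw) = 1 := by
    rw [← lintegral_add_left hm1.lintegral_prod_right']
    have h3 : ∀ s : ChoiceTable m,
        ∫⁻ x, ENNReal.ofReal (1 - ∏ i ∈ R.stock s h x t, (1 - c i))
          ∂(Measure.infinitePi fun _ : ℕ => V) +
        ∫⁻ x, ENNReal.ofReal (∏ i ∈ R.stock s h x t, (1 - c i))
          ∂(Measure.infinitePi fun _ : ℕ => V) = 1 := by
      intro s
      have hm2 : Measurable fun x : ℕ → ℝ≥0 =>
          ENNReal.ofReal (1 - ∏ i ∈ R.stock s h x t, (1 - c i)) := by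
        have h5 := hm1.comp (measurable_prodMk_left (x := s))
        exact h5
      rw [← lintegral_add_left hm2]
      have h4 : ∀ x, ENNReal.ofReal (1 - ∏ i ∈ R.stock s h x t, (1 - c i)) +
          ENNReal.ofReal (∏ i ∈ R.stock s h x t, (1 - c i)) = 1 := fun x => by
        rw [← ENNReal.ofReal_add (sub_nonneg.2 (prod_one_sub_le_one hc0 hc1 _))
          (prod_one_sub_nonneg hc1 _), sub_add_cancel, ENNReal.ofReal_one]
      simp only [h4, lintegral_const, measure_univ, mul_one]
    simp only [h3, lintegral_const, measure_univ, mul_one]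
  rw [ENNReal.ofReal_sub _ hP0, ENNReal.ofReal_one, tsub_le_iff_right, ← hone]
  exact add_le_add le_rfl hP

/-- The chance that buyer `t + 1` has a value above `v` and is served, for given horizons. -/
lemma le_lintegral_served [IsProbabilityMeasure V] (h : Fin m → ℕ) (t : ℕ) (v : ℝ≥0) {θ : ℝ}
    (hθ : θ = V.real (Set.Ioi v)) (hv : 0 < θ) :
    ENNReal.ofReal (θ / 2) * ENNReal.ofReal (1 - ∏ i, (1 -
      min (R.a t i) θ / θ * (∏ k ∈ Finset.range t, (1 - R.a k i)) *
        if t + 1 ≤ h i then 1 else 0)) ≤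
    ∫⁻ s, ∫⁻ x, R.served v t s h x
        ∂(Measure.infinitePi fun _ : ℕ => V) ∂(Measure.infinitePi R.tableLaw) := by
  have hθ1 : θ ≤ 1 := hθ ▸ measureReal_le_one
  have hc0 : ∀ i, 0 ≤ min (R.a t i) θ / θ := fun i =>
    div_nonneg (le_min (R.a_nonneg t i) hv.le) hv.le
  have hc1 : ∀ i, min (R.a t i) θ / θ ≤ 1 := fun i => (div_le_one hv).2 (min_le_right _ _)
  unfold served
  rw [R.lintegral_at_stock h t (Ψ := R.servedIndicator v t) fun U =>
    (R.measurable_servedIndicator t U).comp measurable_prodMk_right]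
  refine (mul_le_mul_right (R.ofReal_one_sub_le_lintegral_stock h t hc0 hc1) _).trans ?_
  refine (lintegral_const_mul_le _ _).trans (lintegral_mono fun s => ?_)
  refine (lintegral_const_mul_le _ _).trans (lintegral_mono fun x => ?_)
  rw [← ENNReal.ofReal_mul (by positivity)]
  refine (ENNReal.ofReal_le_ofReal (le_min_saleProb (R.a_nonneg t) (R.a_le_one t) hv hθ1
    _)).trans ?_
  rw [hθ]
  exact R.le_lintegral_servedIndicator t _ v

lemma lintegral_served_eq [IsProbabilityMeasure V] (H : Fin m → Measure ℕ)
    [∀ i, IsProbabilityMeasure (H i)] (v : ℝ≥0) (t : ℕ) :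
    ∫⁻ ω, R.served v t ω.1 ω.2.1 ω.2.2
        ∂((Measure.infinitePi R.tableLaw).prod
          ((Measure.pi H).prod (Measure.infinitePi fun _ : ℕ => V))) =
      ∫⁻ h, ∫⁻ s, ∫⁻ x, R.served v t s h x
        ∂(Measure.infinitePi fun _ : ℕ => V) ∂(Measure.infinitePi R.tableLaw) ∂Measure.pi H := by
  exact lintegral_prod_prod_swap _ _ _ (R.measurable_served_left v t)

/-- What the policy that removes the items at the rates `inverseResidualLife` earns when each value
above `v` counts as `1` and every other value as `0`. -/
lemma tsum_min_saleRate_le [IsProbabilityMeasure V] (H : Fin m → Measure ℕ)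
    [∀ i, IsProbabilityMeasure (H i)] {f : Fin m → ℕ → ℝ}
    (hf : ∀ i t, f i t = (H i).real (Set.Ici (t + 1))) (hH : ∀ i, IsMHRTail (f i))
    (hR : R.a = fun t i => inverseResidualLife (f i) t) (v : ℝ≥0) {θ : ℝ}
    (hθ : θ = V.real (Set.Ioi v)) :
    ENNReal.ofReal ((∑' t, min θ (∑ i, saleRate (f i) θ t)) / 4) ≤
      ∫⁻ ω, ∑' t, R.served v t ω.1 ω.2.1 ω.2.2
        ∂((Measure.infinitePi R.tableLaw).prod
          ((Measure.pi H).prod (Measure.infinitePi fun _ : ℕ => V))) := by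
  have hθ0 : 0 ≤ θ := hθ ▸ measureReal_nonneg
  rcases hθ0.eq_or_lt with h0 | h0
  · have hz : ∀ t, min θ (∑ i, saleRate (f i) θ t) = 0 := fun t => by
      rw [← h0]
      exact min_eq_left (Finset.sum_nonneg fun i _ => (hH i).saleRate_nonneg le_rfl t)
    simp only [hz, tsum_zero, zero_div, ENNReal.ofReal_zero]
    exact zero_le
  have hy0 : ∀ t, 0 ≤ min θ (∑ i, saleRate (f i) θ t) := fun t =>
    le_min h0.le (Finset.sum_nonneg fun i _ => (hH i).saleRate_nonneg h0.le t)
  have hsum : Summable fun t => min θ (∑ i, saleRate (f i) θ t) :=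
    Summable.of_nonneg_of_le hy0 (fun t => min_le_right _ _)
      (summable_sum fun i _ => (hH i).summable_saleRate h0.le)
  rw [← tsum_div_const, ENNReal.ofReal_tsum_of_nonneg (fun t => div_nonneg (hy0 t) (by norm_num))
    (hsum.div_const 4), lintegral_tsum fun t => (R.measurable_served_left v t).aemeasurable]
  refine ENNReal.tsum_le_tsum fun t => ?_
  rw [R.lintegral_served_eq H v t]
  refine le_trans ?_ (lintegral_mono fun h => R.le_lintegral_served h t v hθ h0)
  rw [lintegral_const_mul _ .of_discrete]
  have hd0 : ∀ i, 0 ≤ min (R.a t i) θ / θ * ∏ k ∈ Finset.range t, (1 - R.a k i) := fun i =>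
    mul_nonneg (div_nonneg (le_min (R.a_nonneg t i) h0.le) h0.le)
      (prod_one_sub_nonneg (fun k => R.a_le_one k i) _)
  have hd1 : ∀ i, min (R.a t i) θ / θ * ∏ k ∈ Finset.range t, (1 - R.a k i) ≤ 1 := fun i =>
    mul_le_one₀ ((div_le_one h0).2 (min_le_right _ _))
      (prod_one_sub_nonneg (fun k => R.a_le_one k i) _)
      (prod_one_sub_le_one (fun k => R.a_nonneg k i) (fun k => R.a_le_one k i) _)
  rw [lintegral_one_sub_prod_horizon H hd0 hd1 t, ← ENNReal.ofReal_mul (by positivity)]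
  refine ENNReal.ofReal_le_ofReal ?_
  have hprod : ∀ i, min (R.a t i) θ / θ * (∏ k ∈ Finset.range t, (1 - R.a k i)) *
      (H i).real (Set.Ici (t + 1)) = saleRate (f i) θ t / θ := fun i => by
    rw [← hf, ← (hH i).min_inverseResidualLife_mul θ t,
      ← (hH i).prod_one_sub_inverseResidualLife t]
    simp only [hR]
  simp_rw [hprod]
  have h3 := half_min_le_one_sub_prod (x := fun i => saleRate (f i) θ t / θ)
    (fun i => div_nonneg ((hH i).saleRate_nonneg h0.le t) h0.le)
    (fun i => (div_le_one h0).2 ((hH i).saleRate_le h0.le t)) Finset.univ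
  rw [← Finset.sum_div] at h3
  have h4 : θ * min 1 ((∑ i, saleRate (f i) θ t) / θ) = min θ (∑ i, saleRate (f i) θ t) := by
    rw [mul_min_of_nonneg _ _ h0.le, mul_one, mul_div_cancel₀ _ h0.ne']
  calc min θ (∑ i, saleRate (f i) θ t) / 4
      = θ / 2 * (min 1 ((∑ i, saleRate (f i) θ t) / θ) / 2) := by rw [← h4]; ring
    _ ≤ _ := mul_le_mul_of_nonneg_left h3 (by positivity)

end ThinningRule

/-! ### Welfare of the prophet at a level, and the comparison -/

/-- The indicator that the value `y` exceeds `v`. -/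
noncomputable def level (v y : ℝ≥0) : ℝ≥0 := if v < y then 1 else 0

lemma measurable_level : Measurable fun z : ℝ≥0 × ℝ≥0 => level z.1 z.2 :=
  Measurable.ite (measurableSet_lt measurable_fst measurable_snd) measurable_const measurable_const

lemma level_le_one (v y : ℝ≥0) : level v y ≤ 1 := by unfold level; split_ifs <;> simp

lemma lintegral_level {l : Measure ℝ≥0} (hl : ∀ x : ℝ≥0, l (Set.Iio x) = x) (y : ℝ≥0) :
    ∫⁻ v, (level v y : ℝ≥0∞) ∂l = y := by
  have h : ∀ v, (level v y : ℝ≥0∞) = (Set.Iio y).indicator 1 v := fun v => by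
    simp [level, Set.indicator_apply, apply_ite ((↑) : ℝ≥0 → ℝ≥0∞)]
  simp_rw [h]
  rw [lintegral_indicator_one measurableSet_Iio, hl]

lemma lintegral_level_value (V : Measure ℝ≥0) [IsProbabilityMeasure V] (v : ℝ≥0) (t : ℕ) :
    ∫⁻ x, (level v (x t) : ℝ≥0∞) ∂(Measure.infinitePi fun _ : ℕ => V) =
      ENNReal.ofReal (V.real (Set.Ioi v)) := by
  have hm : Measurable fun y : ℝ≥0 => (level v y : ℝ≥0∞) :=
    (measurable_level.comp measurable_prodMk_left).coe_nnreal_ennreal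
  rw [(measurePreserving_eval_infinitePi (fun _ : ℕ => V) t).lintegral_comp hm]
  have h : ∀ y, (level v y : ℝ≥0∞) = (Set.Ioi v).indicator 1 y := fun y => by
    simp [level, Set.indicator_apply, apply_ite ((↑) : ℝ≥0 → ℝ≥0∞)]
  simp_rw [h]
  rw [lintegral_indicator_one measurableSet_Ioi, ofReal_measureReal]

section Prophet

variable {m : ℕ}

lemma measurable_assignmentValue (σ : Fin m → Option ℕ) :
    Measurable fun x : ℕ → ℝ≥0 => assignmentValue x σ := by
  unfold assignmentValue
  refine Finset.measurable_sum _ fun i _ => ?_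
  rcases σ i with _ | t
  · exact measurable_const
  · exact (measurable_pi_apply t).coe_nnreal_ennreal

lemma measurable_prophetWelfare :
    Measurable fun z : (Fin m → ℕ) × (ℕ → ℝ≥0) => prophetWelfare z.1 z.2 := by
  refine measurable_from_prod_countable_right fun h => ?_
  exact Measurable.iSup fun σ => Measurable.iSup_Prop (IsFeasible h σ)
    (measurable_assignmentValue σ)

/-- The layer-cake bound: the prophet does at least as well when he may adapt his assignment to
each level. -/
lemma prophetWelfare_le_lintegral_level {l : Measure ℝ≥0} (hl : ∀ x : ℝ≥0, l (Set.Iio x) = x)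
    (h : Fin m → ℕ) (x : ℕ → ℝ≥0) :
    prophetWelfare h x ≤ ∫⁻ v, prophetWelfare h (fun t => level v (x t)) ∂l := by
  refine iSup₂_le fun σ hσ => ?_
  have hv : ∀ v, assignmentValue (fun t => level v (x t)) σ ≤
      prophetWelfare h (fun t => level v (x t)) := fun v =>
    le_iSup₂ (f := fun (σ : Fin m → Option ℕ) (_ : IsFeasible h σ) =>
      assignmentValue (fun t => level v (x t)) σ) σ hσ
  refine le_trans (le_of_eq ?_) (lintegral_mono hv)
  unfold assignmentValue
  rw [lintegral_finsetSum]
  · refine Finset.sum_congr rfl fun i _ => ?_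
    rcases σ i with _ | t
    · simp
    · exact (lintegral_level hl (x t)).symm
  · intro i _
    rcases σ i with _ | t
    · exact measurable_const
    · exact (measurable_level.comp measurable_prodMk_right).coe_nnreal_ennreal

/-- With values at most `1`, the prophet gets no more than all of the first `N` buyers and, from
each item, either all buyers of its remaining life or, if the item is still there, the value `1`. -/
lemma prophetWelfare_le (h : Fin m → ℕ) {x : ℕ → ℝ≥0} (hx : ∀ t, x t ≤ 1) (N : ℕ)
    (B : Fin m → Prop) [DecidablePred B] :
    prophetWelfare h x ≤ ∑ t ∈ Finset.range N, (x t : ℝ≥0∞) +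
      ∑ i, if B i then ∑' k, (if N + k + 1 ≤ h i then 1 else 0) * (x (N + k) : ℝ≥0∞)
        else if N + 1 ≤ h i then 1 else 0 := by
  refine iSup₂_le fun σ hσ => ?_
  have hsplit : assignmentValue x σ ≤
      ∑ i, ∑ t ∈ Finset.range N, (if σ i = some t then (x t : ℝ≥0∞) else 0) +
      ∑ i, if B i then ∑' k, (if N + k + 1 ≤ h i then 1 else 0) * (x (N + k) : ℝ≥0∞)
        else if N + 1 ≤ h i then 1 else 0 := by
    rw [← Finset.sum_add_distrib]
    refine Finset.sum_le_sum fun i _ => ?_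
    rcases hi : σ i with _ | t
    · exact zero_le
    · have hti := hσ.1 i t hi
      rcases lt_or_ge t N with htN | htN
      · refine le_add_right ?_
        simp [htN]
      · refine le_add_left ?_
        obtain ⟨k, rfl⟩ := Nat.exists_eq_add_of_le htN
        split_ifs with hB hN
        · refine le_trans (le_of_eq ?_) (ENNReal.le_tsum k)
          rw [if_pos hti, one_mul]
        · exact ENNReal.coe_le_one_iff.2 (hx _)
        · omega
  refine hsplit.trans (add_le_add ?_ le_rfl)
  rw [Finset.sum_comm]
  refine Finset.sum_le_sum fun t _ => ?_
  rw [← Finset.sum_filter, Finset.sum_const, nsmul_eq_mul]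
  refine (mul_le_mul_left ?_ _).trans (one_mul _).le
  have hcard : (Finset.univ.filter fun i => σ i = some t).card ≤ 1 :=
    Finset.card_le_one.2 fun i hi j hj =>
      hσ.2 i j t (Finset.mem_filter.1 hi).2 (Finset.mem_filter.1 hj).2
  exact_mod_cast hcard

lemma lintegral_horizon (H : Fin m → Measure ℕ) [∀ i, IsProbabilityMeasure (H i)] (i : Fin m)
    (t : ℕ) : ∫⁻ h, (if t + 1 ≤ h i then 1 else 0 : ℝ≥0∞) ∂Measure.pi H =
      ENNReal.ofReal ((H i).real (Set.Ici (t + 1))) := by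
  have hm : Measurable fun n : ℕ => (if t + 1 ≤ n then 1 else 0 : ℝ≥0∞) := .of_discrete
  rw [(measurePreserving_eval H i).lintegral_comp hm]
  have h : ∀ n : ℕ, (if t + 1 ≤ n then 1 else 0 : ℝ≥0∞) = (Set.Ici (t + 1)).indicator 1 n :=
    fun n => by simp [Set.indicator_apply]
  simp_rw [h]
  rw [lintegral_indicator_one measurableSet_Ici, ofReal_measureReal]

/-- The expected number of buyers of value above `v` that the prophet can serve. -/
lemma lintegral_prophetWelfare_level_le (H : Fin m → Measure ℕ) [∀ i, IsProbabilityMeasure (H i)]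
    (V : Measure ℝ≥0) [IsProbabilityMeasure V] {f : Fin m → ℕ → ℝ}
    (hf : ∀ i t, f i t = (H i).real (Set.Ici (t + 1))) (hH : ∀ i, IsMHRTail (f i)) (v : ℝ≥0)
    {θ : ℝ} (hθ : θ = V.real (Set.Ioi v)) (N : ℕ) :
    ∫⁻ z, prophetWelfare z.1 (fun t => level v (z.2 t))
        ∂((Measure.pi H).prod (Measure.infinitePi fun _ : ℕ => V)) ≤
      ENNReal.ofReal (N * θ + ∑ i, min (f i N) (θ * tailSum (f i) N)) := by
  classical
  have hθ0 : 0 ≤ θ := hθ ▸ measureReal_nonneg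
  set ν := Measure.infinitePi fun _ : ℕ => V with hν
  have hmin0 : ∀ i, 0 ≤ min (f i N) (θ * tailSum (f i) N) := fun i =>
    le_min ((hH i).nonneg N) (mul_nonneg hθ0 ((hH i).tailSum_nonneg N))
  have hlv : ∀ t, Measurable fun x : ℕ → ℝ≥0 => (level v (x t) : ℝ≥0∞) := fun t =>
    (measurable_level.comp (measurable_const.prodMk (measurable_pi_apply t))).coe_nnreal_ennreal
  have hlv2 : ∀ t, Measurable fun z : (Fin m → ℕ) × (ℕ → ℝ≥0) => (level v (z.2 t) : ℝ≥0∞) :=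
    fun t => (hlv t).comp measurable_snd
  have hlvE : ∀ t, ∫⁻ z : (Fin m → ℕ) × (ℕ → ℝ≥0), (level v (z.2 t) : ℝ≥0∞)
      ∂((Measure.pi H).prod ν) = ENNReal.ofReal θ := fun t => by
    refine (measurePreserving_snd.lintegral_comp (hlv t)).trans ?_
    rw [hθ]
    exact lintegral_level_value V v t
  have hE1 : ∀ i t, ∫⁻ z : (Fin m → ℕ) × (ℕ → ℝ≥0), (if t + 1 ≤ z.1 i then 1 else 0 : ℝ≥0∞)
      ∂((Measure.pi H).prod ν) = ENNReal.ofReal (f i t) := fun i t => by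
    have hm : Measurable fun h : Fin m → ℕ => (if t + 1 ≤ h i then 1 else 0 : ℝ≥0∞) := .of_discrete
    refine (measurePreserving_fst.lintegral_comp hm).trans ?_
    rw [hf]
    exact lintegral_horizon H i t
  have hE2 : ∀ i t, ∫⁻ z : (Fin m → ℕ) × (ℕ → ℝ≥0),
      (if t + 1 ≤ z.1 i then 1 else 0 : ℝ≥0∞) * (level v (z.2 t) : ℝ≥0∞)
      ∂((Measure.pi H).prod ν) = ENNReal.ofReal (f i t * θ) := fun i t => by
    rw [lintegral_prod_mul (f := fun h : Fin m → ℕ => (if t + 1 ≤ h i then 1 else 0 : ℝ≥0∞))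
      (g := fun x : ℕ → ℝ≥0 => (level v (x t) : ℝ≥0∞)) (Measurable.of_discrete).aemeasurable
      (hlv t).aemeasurable, lintegral_horizon, lintegral_level_value,
      ENNReal.ofReal_mul ((hH i).nonneg t), hf, hθ]
  have hm1 : ∀ i t, Measurable fun z : (Fin m → ℕ) × (ℕ → ℝ≥0) =>
      (if t + 1 ≤ z.1 i then 1 else 0 : ℝ≥0∞) := fun i t =>
    (Measurable.of_discrete (f := fun h : Fin m → ℕ =>
      (if t + 1 ≤ h i then 1 else 0 : ℝ≥0∞))).comp measurable_fst
  have hm12 : ∀ i t, Measurable fun z : (Fin m → ℕ) × (ℕ → ℝ≥0) =>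
      (if t + 1 ≤ z.1 i then 1 else 0 : ℝ≥0∞) * (level v (z.2 t) : ℝ≥0∞) := fun i t =>
    (hm1 i t).mul (hlv2 t)
  refine (lintegral_mono fun z :
    (Fin m → ℕ) × (ℕ → ℝ≥0) => prophetWelfare_le z.1 (fun t => level_le_one v (z.2 t)) N
    fun i => θ * tailSum (f i) N ≤ f i N).trans (le_of_eq ?_)
  rw [lintegral_add_left (Finset.measurable_sum _ fun t _ => hlv2 t),
    lintegral_finsetSum _ fun t _ => hlv2 t, lintegral_finsetSum,
    ENNReal.ofReal_add (mul_nonneg N.cast_nonneg hθ0) (Finset.sum_nonneg fun i _ => hmin0 i),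
    ENNReal.ofReal_sum_of_nonneg fun i _ => hmin0 i]
  · congr 1
    · simp only [hlvE, Finset.sum_const, Finset.card_range, nsmul_eq_mul]
      rw [ENNReal.ofReal_mul N.cast_nonneg, ENNReal.ofReal_natCast]
    · refine Finset.sum_congr rfl fun i _ => ?_
      by_cases hB : θ * tailSum (f i) N ≤ f i N
      · simp only [hB, if_true]
        rw [min_eq_right hB, lintegral_tsum fun k => (hm12 i (N + k)).aemeasurable]
        simp only [hE2]
        rw [← ENNReal.ofReal_tsum_of_nonneg (fun k => mul_nonneg ((hH i).nonneg _) hθ0)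
          (((hH i).summable_shift N).mul_right θ), tsum_mul_right, mul_comm]
        rfl
      · simp only [hB, if_false]
        rw [min_eq_left (not_le.1 hB).le, hE1]
  · intro i _
    by_cases hB : θ * tailSum (f i) N ≤ f i N
    · simp only [hB, if_true]
      exact Measurable.tsum fun k => hm12 i (N + k)
    · simp only [hB, if_false]
      exact hm1 i N

end Prophet

namespace ThinningRule

variable {m : ℕ} {V : Measure ℝ≥0} (R : ThinningRule m V)

lemma lintegral_served {l : Measure ℝ≥0} (hl : ∀ x : ℝ≥0, l (Set.Iio x) = x) (t : ℕ)
    (s : ChoiceTable m) (h : Fin m → ℕ) (x : ℕ → ℝ≥0) :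
    ∫⁻ v, R.served v t s h x ∂l =
      if (R.policy.saleAt s h x t).isSome then (x t : ℝ≥0∞) else 0 := by
  by_cases hs : (R.policy.saleAt s h x t).isSome
  · rw [if_pos hs, ← lintegral_level hl (x t)]
    refine lintegral_congr fun v => ?_
    have := (R.isSome_saleAt s h x t).1 hs
    simp [served, servedIndicator, level, this, apply_ite ((↑) : ℝ≥0 → ℝ≥0∞)]
  · rw [if_neg hs]
    have := mt (R.isSome_saleAt s h x t).2 hs
    simp [served, servedIndicator, this]

lemma expectedWelfare_policy_eq [IsProbabilityMeasure V] {l : Measure ℝ≥0} [SFinite l]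
    (hl : ∀ x : ℝ≥0, l (Set.Iio x) = x) (H : Fin m → Measure ℕ)
    [∀ i, IsProbabilityMeasure (H i)] :
    R.policy.expectedWelfare H V = ∫⁻ v, ∫⁻ ω, ∑' t, R.served v t ω.1 ω.2.1 ω.2.2
      ∂((Measure.infinitePi R.tableLaw).prod
        ((Measure.pi H).prod (Measure.infinitePi fun _ : ℕ => V))) ∂l := by
  have hm : Measurable fun z : (ChoiceTable m × (Fin m → ℕ) × (ℕ → ℝ≥0)) × ℝ≥0 =>
      ∑' t, R.served z.2 t z.1.1 z.1.2.1 z.1.2.2 := Measurable.tsum R.measurable_served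
  have hw : ∀ ω : ChoiceTable m × (Fin m → ℕ) × (ℕ → ℝ≥0),
      R.policy.welfare ω.1 ω.2.1 ω.2.2 = ∫⁻ v, ∑' t, R.served v t ω.1 ω.2.1 ω.2.2 ∂l := by
    intro ω
    have hmv : ∀ t, Measurable fun v => R.served v t ω.1 ω.2.1 ω.2.2 := fun t => by
      have h2 := (R.measurable_served t).comp (measurable_prodMk_left (x := ω))
      exact h2
    rw [lintegral_tsum fun t => (hmv t).aemeasurable]
    exact tsum_congr fun t => (R.lintegral_served hl t ω.1 ω.2.1 ω.2.2).symm
  unfold PricingPolicy.expectedWelfare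
  refine (lintegral_congr hw).trans ?_
  exact lintegral_lintegral_swap (f := fun (ω : ChoiceTable m × (Fin m → ℕ) × (ℕ → ℝ≥0)) v =>
    ∑' t, R.served v t ω.1 ω.2.1 ω.2.2) hm.aemeasurable

end ThinningRule

theorem theorem1 (m : ℕ) (hm : 1 ≤ m)
    (H : Fin m → Measure ℕ) [∀ i, IsProbabilityMeasure (H i)]
    (hpos : ∀ i, H i {0} = 0) (hMHR : ∀ i, IsMHR (H i))
    (V : Measure ℝ≥0) [IsProbabilityMeasure V] :
    ∃ π : PricingPolicy m,
      expectedProphetWelfare H V ≤ (105 / 2 : ℝ≥0∞) * π.expectedWelfare H V := by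
  set f : Fin m → ℕ → ℝ := fun i t => (H i).real (Set.Ici (t + 1)) with hf
  have hH : ∀ i, IsMHRTail (f i) := fun i => (hMHR i).isMHRTail (hpos i)
  obtain ⟨R, hR⟩ := exists_thinningRule hm V (a := fun t i => inverseResidualLife (f i) t)
    (fun t i => (hH i).inverseResidualLife_nonneg t)
    (fun t i => (hH i).inverseResidualLife_le_one t)
  obtain ⟨l, hlfin, hl⟩ := exists_layer_measure
  refine ⟨R.policy, ?_⟩
  rw [R.expectedWelfare_policy_eq hl H, expectedProphetWelfare]
  set W : ℝ≥0 → ℝ≥0∞ := fun v => ∫⁻ ω, ∑' t, R.served v t ω.1 ω.2.1 ω.2.2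
      ∂((Measure.infinitePi R.tableLaw).prod
        ((Measure.pi H).prod (Measure.infinitePi fun _ : ℕ => V))) with hW
  have hlevel : ∀ v, ∫⁻ z, prophetWelfare z.1 (fun t => level v (z.2 t))
      ∂((Measure.pi H).prod (Measure.infinitePi fun _ : ℕ => V)) ≤ 16 * W v := by
    intro v
    have hθ0 : 0 ≤ V.real (Set.Ioi v) := measureReal_nonneg
    obtain ⟨τ, hτ⟩ := exists_cutoff hH hθ0
    refine (lintegral_prophetWelfare_level_le H V (fun _ _ => rfl) hH v rfl (2 * τ)).trans ?_
    refine le_trans ?_ (mul_le_mul_right (R.tsum_min_saleRate_le H (fun _ _ => rfl) hH hR v rfl)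
      16)
    rw [← ENNReal.ofReal_ofNat 16, ← ENNReal.ofReal_mul (by norm_num)]
    refine ENNReal.ofReal_le_ofReal (hτ.trans (le_of_eq ?_))
    ring
  have hmp : Measurable fun z : ((Fin m → ℕ) × (ℕ → ℝ≥0)) × ℝ≥0 =>
      prophetWelfare z.1.1 (fun t => level z.2 (z.1.2 t)) := by
    have h1 : Measurable fun z : ((Fin m → ℕ) × (ℕ → ℝ≥0)) × ℝ≥0 =>
        (z.1.1, fun t => level z.2 (z.1.2 t)) :=
      measurable_fst.fst.prodMk (measurable_pi_lambda _ fun t => measurable_level.comp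
        (measurable_snd.prodMk ((measurable_pi_apply t).comp measurable_fst.snd)))
    have h2 := (measurable_prophetWelfare (m := m)).comp h1
    exact h2
  calc ∫⁻ z, prophetWelfare z.1 z.2 ∂((Measure.pi H).prod (Measure.infinitePi fun _ : ℕ => V))
      ≤ ∫⁻ z, ∫⁻ v, prophetWelfare z.1 (fun t => level v (z.2 t)) ∂l
          ∂((Measure.pi H).prod (Measure.infinitePi fun _ : ℕ => V)) :=
        lintegral_mono fun z => prophetWelfare_le_lintegral_level hl z.1 z.2
    _ = ∫⁻ v, ∫⁻ z, prophetWelfare z.1 (fun t => level v (z.2 t))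
          ∂((Measure.pi H).prod (Measure.infinitePi fun _ : ℕ => V)) ∂l :=
        lintegral_lintegral_swap (f := fun (z : (Fin m → ℕ) × (ℕ → ℝ≥0)) v =>
          prophetWelfare z.1 (fun t => level v (z.2 t))) hmp.aemeasurable
    _ ≤ ∫⁻ v, 16 * W v ∂l := lintegral_mono hlevel
    _ = 16 * ∫⁻ v, W v ∂l := lintegral_const_mul' _ _ (by norm_num)
    _ ≤ 105 / 2 * ∫⁻ v, W v ∂l := by
        refine mul_le_mul_left ?_ _
        rw [ENNReal.le_div_iff_mul_le (by norm_num) (by norm_num)]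
        norm_num
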